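/- Let $n\ge 3$ and $\Lambda\in\mathbb R$. Let $U\subseteq\mathbb R^n$ be open, with coordinates $(t,x_1,\dots,x_{n-1})$. Let $\bar g=\Omega\,\eta$ with $\eta=-dt^2+dx_1^2+\dots+dx_{n-1}^2$, where on $U$ either $\Omega=1$ (Minkowski), or $\Omega=\frac{(n-2)(n-1)}{2\bar\Lambda t^2}$ with $\bar\Lambda>0$ and $t\neq0$ (de Sitter), or $\Omega=-\frac{(n-2)(n-1)}{2\bar\Lambda x_1^2}$ with $\bar\Lambda<0$ and $x_1\ne0$ (anti-de Sitter). An extended Kerr–Schild metric on $U$ is a metric $$g_{ab}=\bar g_{ab}-2\mathcal H\,k_ak_b-\mathcal K\,(k_am_b+k_bm_a),$$ where $\mathcal H,\mathcal K$ are smooth functions and $k_a,m_a$ smooth one-forms on $U$ such that, with indices raised by $g$, $k_a$ vanishes nowhere, $k^ak_a=0$, $k^am_a=0$ and $m^am_a=1$. The vector $k$ is called geodetic if $k_{a;b}k^b=f\,k_a$ on $U$ for some function $f$, where $;$ is the Levi-Civita derivative of $g$. The energy–momentum tensor $T_{ab}$ is given by the Einstein field equations $R_{ab}-\frac12Rg_{ab}+\Lambda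 g_{ab}=8\pi T_{ab}$, and $T_{00}=T_{ab}k^ak^b$. Then: 1. If the Kerr–Schild vector $k$ of an extended Kerr–Schild metric is geodetic, then $T_{00}=0$ on $U$. 2. If moreover $(\mathcal L_k m)_a=\varphi\,m_a$ for some function $\varphi$ and $(\mathcal L_m k)_a=0$ on $U$ (Lie derivatives of the one-forms $m_a,k_a$ along the vector fields $k^a,m^a$), and if $4\mathcal H\neq\mathcal K^2$ on a dense subset of $U$, then $k$ is geodetic if and only if $T_{00}=0$ on $U$. 3. In general the converse of 1 fails: for all $n\ge3$ and $\Lambda$ there is an extended Kerr–Schild metric on $\mathbb R^n$, with $\mathcal K\ne0$ and $4\mathcal H\neq\mathcal K^2$ everywhere, such that $T_{00}=0$ everywhere but $k$ is not geodetic. -/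

import Mathlib

open scoped ContDiff

noncomputable section

namespace XKS

/-- Coordinate points `(t, x₁, …, x_{n-1})`; the coordinate with index `0` is the time `t`. -/
abbrev Pt (n : ℕ) := Fin n → ℝ

/-- A scalar field in the coordinate chart. -/
abbrev Scalar (n : ℕ) := Pt n → ℝ

/-- The components of a vector field or of a one-form in the coordinate chart. -/
abbrev Field (n : ℕ) := Pt n → Fin n → ℝ

/-- The components of a covariant tensor field of rank two in the coordinate chart. -/
abbrev Tensor2 (n : ℕ) := Pt n → Matrix (Fin n) (Fin n) ℝ

variable {n : ℕ}

/-- The partial derivative `f_{,a}` at the point `x`. -/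
def pd (a : Fin n) (f : Scalar n) (x : Pt n) : ℝ := fderiv ℝ f x (Pi.single a 1)

/-- Raising the index of a one-form: `α^a = g^{ab} α_b`. -/
def raise (g : Tensor2 n) (α : Field n) : Field n :=
  fun x a => ∑ b, (g x)⁻¹ a b * α x b

/-- The contraction `X^a α_a`. -/
def contract (X α : Field n) : Scalar n := fun x => ∑ a, X x a * α x a

/-- Christoffel symbols `Γ^a_{bc}` of the metric `g`. -/
def christoffel (g : Tensor2 n) (a b c : Fin n) (x : Pt n) : ℝ :=
  (1 / 2) * ∑ d, (g x)⁻¹ a d *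
    (pd b (fun y => g y d c) x + pd c (fun y => g y d b) x - pd d (fun y => g y b c) x)

/-- The covariant derivative `α_{a;b}` of a one-form. -/
def covDeriv (g : Tensor2 n) (α : Field n) (a b : Fin n) (x : Pt n) : ℝ :=
  pd b (fun y => α y a) x - ∑ c, christoffel g c a b x * α x c

/-- The Ricci tensor
`R_{ab} = Γ^c_{ab,c} - Γ^c_{ac,b} + Γ^c_{ec} Γ^e_{ab} - Γ^c_{eb} Γ^e_{ac}`. -/
def ricci (g : Tensor2 n) : Tensor2 n := fun x => Matrix.of fun a b =>
  (∑ c, (pd c (christoffel g c a b) x - pd b (christoffel g c a c) x)) +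
    ∑ c, ∑ e, (christoffel g c e c x * christoffel g e a b x -
      christoffel g c e b x * christoffel g e a c x)

/-- The Ricci scalar `R = g^{ab} R_{ab}`. -/
def ricciScalar (g : Tensor2 n) : Scalar n :=
  fun x => ∑ a, ∑ b, (g x)⁻¹ a b * ricci g x a b

/-- The Einstein field equations
`R_{ab} - (1/2) R g_{ab} + Λ g_{ab} = 8 π T_{ab}` on `U`. -/
def EinsteinEquations (U : Set (Pt n)) (Λ : ℝ) (g T : Tensor2 n) : Prop :=
  ∀ x ∈ U, ∀ a b : Fin n,
    ricci g x a b - (1 / 2) * ricciScalar g x * g x a b + Λ * g x a b = 8 * Real.pi * T x a b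

/-- The component `T_{00} = T_{ab} k^a k^b`, where `k^a = g^{ab} k_b`. -/
def T00 (g T : Tensor2 n) (k : Field n) : Scalar n :=
  fun x => ∑ a, ∑ b, T x a b * raise g k x a * raise g k x b

/-- The one-form `α` is pointwise proportional to the one-form `θ` on `U`: `α_a = f θ_a`. -/
def ProportionalOn (U : Set (Pt n)) (α θ : Field n) : Prop :=
  ∃ f : Scalar n, ∀ x ∈ U, ∀ a, α x a = f x * θ x a

/-- `k` is geodetic with respect to `g` on `U`: `k_{a;b} k^b ∝ k_a`. -/
def IsGeodetic (U : Set (Pt n)) (g : Tensor2 n) (k : Field n) : Prop :=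
  ProportionalOn U (fun x a => ∑ b, covDeriv g k a b x * raise g k x b) k

/-- The Lie derivative of a one-form along a vector field:
`(ℒ_X α)_a = X^b α_{a,b} + X^b_{,a} α_b`. -/
def lieDeriv (X α : Field n) : Field n :=
  fun x a => ∑ b, (X x b * pd b (fun y => α y a) x + pd a (fun y => X y b) x * α x b)

/-- The Minkowski metric `-dt² + dx₁² + … + dx_{n-1}²`. -/
def minkowski (n : ℕ) [NeZero n] : Matrix (Fin n) (Fin n) ℝ :=
  Matrix.diagonal fun a => if a = 0 then -1 else 1

/-- The conformal factor of a Minkowski, de Sitter or anti-de Sitter background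
with cosmological constant `Λ` (zero, positive or negative, respectively). -/
def IsBackgroundFactor [NeZero n] (U : Set (Pt n)) (Ω : Scalar n) : Prop :=
  (∀ x ∈ U, Ω x = 1) ∨
  (∃ Λ : ℝ, 0 < Λ ∧ ∀ x ∈ U, x 0 ≠ 0 ∧
    Ω x = ((n : ℝ) - 2) * ((n : ℝ) - 1) / (2 * Λ * x 0 ^ 2)) ∨
  (∃ Λ : ℝ, Λ < 0 ∧ ∀ x ∈ U, x 1 ≠ 0 ∧
    Ω x = -(((n : ℝ) - 2) * ((n : ℝ) - 1) / (2 * Λ * x 1 ^ 2)))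

/-- `gbar` is a Minkowski or (anti-)de Sitter metric in conformally flat form on `U`. -/
def IsBackground [NeZero n] (U : Set (Pt n)) (gbar : Tensor2 n) : Prop :=
  ∃ Ω : Scalar n, IsBackgroundFactor U Ω ∧ ∀ x ∈ U, gbar x = Ω x • minkowski n

/-- The extended Kerr–Schild metric
`g_{ab} = gbar_{ab} - 2 H k_a k_b - 2 K k_{(a} m_{b)}` on `U`. The fields `k` and `m` are given
by their covariant components; `k` is null, `m` is a unit spacelike vector, and they are
orthogonal, all with respect to the full metric `g`. -/
structure IsExtendedKerrSchild [NeZero n] (U : Set (Pt n)) (gbar g : Tensor2 n)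
    (H K : Scalar n) (k m : Field n) : Prop where
  background : IsBackground U gbar
  smooth_H : ContDiffOn ℝ ∞ H U
  smooth_K : ContDiffOn ℝ ∞ K U
  smooth_k : ContDiffOn ℝ ∞ k U
  smooth_m : ContDiffOn ℝ ∞ m U
  metric_eq : ∀ x ∈ U, ∀ a b : Fin n,
    g x a b = gbar x a b - 2 * H x * (k x a * k x b) - K x * (k x a * m x b + k x b * m x a)
  k_ne_zero : ∀ x ∈ U, k x ≠ 0
  k_null : ∀ x ∈ U, contract (raise g k) k x = 0
  k_orthogonal_m : ∀ x ∈ U, contract (raise g k) m x = 0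
  m_unit : ∀ x ∈ U, contract (raise g m) m x = 1

end XKS

end

/-!
For an extended Kerr–Schild metric `g = ḡ - 2 H k k - K (k m + m k)` the theorem follows from one
identity for `R_{ab} k^a k^b`, which by the Einstein equations is `8 π T₀₀` because `k` is null.
Write `w_a = k^b k_{a,b}` for the acceleration of `k` and `μ = w_a m^a`.

* In all three cases the background is `ḡ = s⁻² η` with `s` an affine function. Its connection is
  explicit (`confConn`), it is an Einstein space (`connRicci_confConn`), and raising the index of
  `k` with `g` or with `ḡ` gives the same vector (`KSChart.raise_k`).
* The Bochner (Raychaudhuri) identity `connRicci_apply_apply` expresses `R_{ab} k^a k^b` through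
  `N = ∇k` only, as `div (N k) - tr N² - k (tr N)`. It holds for both connections, so only the
  differences of the three terms matter, and the background curvature drops out.
* Lowering an index, `∇_a k_d` is half the sum of the exterior derivative of `k` and the Lie
  derivative of the metric along `k` (`mul_covVec`). The exterior derivative does not depend on the
  metric, so `g N` and `ḡ B`, where `B` is the background derivative, differ by half the Lie
  derivative of the Kerr–Schild terms, a combination of products of the one-forms `k`, `m`, `w`
  and `ℒ_k m`. As `k` is null and orthogonal to all of them, most traces vanish
  (`KSPoint.trace_covVec_sq`). The contracted Christoffel symbols agree for both metrics
  (`KSChart.sum_christoffel_eq`).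

The outcome is `KSChart.ricci_k_k`: the component `R_{ab} k^a k^b` is
`div (K μ k) + K (ℒ_m k + ℒ_k m)(w^♯) + 2 H |w|² + k(K) μ - K² (μ² + |w|²) / 2`.
If `k` is geodetic, `w` is a multiple of `k` and every term vanishes. Under the Lie derivative
conditions `μ = -(ℒ_m k)(k) = 0` and what remains is `(4 H - K²) |w|² / 2`; if it vanishes and
`4 H ≠ K²` on a dense set, then `w` is null by continuity and, being orthogonal to the null vector
`k`, proportional to it. For the failure of the converse in general, take in Minkowski space
`k = -dt + cos t dx₁ + sin t dx₂`, `m = -sin t dx₁ + cos t dx₂`, `H = 0` and `K = 1`: then `w = m`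
is not proportional to `k`, and the terms of the formula cancel.
-/

namespace XKS

variable {n : ℕ}

open Filter Topology Matrix

/-! ### Partial derivatives -/

theorem pd_congr {f h : Scalar n} {x : Pt n} (a : Fin n) (hfh : f =ᶠ[𝓝 x] h) :
    pd a f x = pd a h x := by
  unfold pd; rw [hfh.fderiv_eq]

theorem pd_const (a : Fin n) (c : ℝ) (x : Pt n) : pd a (fun _ => c) x = 0 := by
  simp [pd]

theorem pd_add {f h : Scalar n} {x : Pt n} (a : Fin n) (hf : DifferentiableAt ℝ f x)
    (hh : DifferentiableAt ℝ h x) : pd a (fun y => f y + h y) x = pd a f x + pd a h x := by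
  unfold pd; rw [fderiv_fun_add hf hh]; rfl

theorem pd_sub {f h : Scalar n} {x : Pt n} (a : Fin n) (hf : DifferentiableAt ℝ f x)
    (hh : DifferentiableAt ℝ h x) : pd a (fun y => f y - h y) x = pd a f x - pd a h x := by
  unfold pd; rw [fderiv_fun_sub hf hh]; rfl

theorem pd_mul {f h : Scalar n} {x : Pt n} (a : Fin n) (hf : DifferentiableAt ℝ f x)
    (hh : DifferentiableAt ℝ h x) :
    pd a (fun y => f y * h y) x = pd a f x * h x + f x * pd a h x := by
  unfold pd; rw [fderiv_fun_mul hf hh]; simp; ring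

theorem pd_const_mul {f : Scalar n} {x : Pt n} (a : Fin n) (c : ℝ)
    (hf : DifferentiableAt ℝ f x) : pd a (fun y => c * f y) x = c * pd a f x := by
  rw [pd_mul a (differentiableAt_const c) hf, pd_const]; ring

theorem pd_sum {ι : Type*} {s : Finset ι} {f : ι → Scalar n} {x : Pt n} (a : Fin n)
    (hf : ∀ i ∈ s, DifferentiableAt ℝ (f i) x) :
    pd a (fun y => ∑ i ∈ s, f i y) x = ∑ i ∈ s, pd a (f i) x := by
  unfold pd; rw [fderiv_fun_sum hf]; simp

theorem contDiffAt_pd {f : Scalar n} {x : Pt n} (a : Fin n) (hf : ContDiffAt ℝ ∞ f x) :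
    ContDiffAt ℝ ∞ (pd a f) x :=
  (hf.fderiv_right (m := ∞) (by simp)).clm_apply contDiffAt_const

theorem _root_.ContDiffAt.diffAt {f : Scalar n} {x : Pt n} (hf : ContDiffAt ℝ ∞ f x) :
    DifferentiableAt ℝ f x :=
  hf.differentiableAt (by simp)

theorem pd_comm {f : Scalar n} {x : Pt n} (a b : Fin n) (hf : ContDiffAt ℝ ∞ f x) :
    pd a (pd b f) x = pd b (pd a f) x := by
  have hd : DifferentiableAt ℝ (fderiv ℝ f) x :=
    (hf.fderiv_right (m := ∞) (by simp)).differentiableAt (by simp)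
  have key : ∀ u v : Fin n, pd u (pd v f) x
      = fderiv ℝ (fderiv ℝ f) x (Pi.single u 1) (Pi.single v 1) := by
    intro u v
    change fderiv ℝ (fun y => fderiv ℝ f y (Pi.single v 1)) x (Pi.single u 1) = _
    rw [fderiv_clm_apply hd (differentiableAt_const _)]
    simp
  rw [key, key]
  refine (hf.isSymmSndFDerivAt ?_) _ _
  simp only [minSmoothness_of_isRCLikeNormedField]
  exact WithTop.coe_le_coe.2 le_top

/-! ### The Bochner identity for a symmetric connection -/

/-- The Ricci tensor of the connection with coefficients `Γ`, by the same coordinate formula as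
for the Levi-Civita connection. -/
noncomputable def connRicci (Γ : Fin n → Fin n → Fin n → Scalar n) (a b : Fin n) (x : Pt n) : ℝ :=
  (∑ c, (pd c (Γ c a b) x - pd b (Γ c a c) x)) +
    ∑ c, ∑ e, (Γ c e c x * Γ e a b x - Γ c e b x * Γ e a c x)

/-- The covariant derivative `∇_a X^c` of a vector field, as the matrix with row index `c` and
column index `a`. -/
noncomputable def covVec (Γ : Fin n → Fin n → Fin n → Scalar n) (X : Field n) (x : Pt n) :
    Matrix (Fin n) (Fin n) ℝ :=
  Matrix.of fun c a => pd a (fun y => X y c) x + ∑ e, Γ c a e x * X x e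

/-- The index manipulation behind the Bochner identity, with the jets of `Γ` and `X` replaced
by arbitrary numbers. -/
theorem bochner_algebra (X : Fin n → ℝ) (D : Fin n → Fin n → ℝ) (E : Fin n → Fin n → Fin n → ℝ)
    (Γ : Fin n → Fin n → Fin n → ℝ) (dΓ : Fin n → Fin n → Fin n → Fin n → ℝ)
    (hE : ∀ a b c, E a b c = E b a c) (hΓ : ∀ a b c, Γ a b c = Γ a c b)
    (hdΓ : ∀ d a b c, dΓ d a b c = dΓ d a c b) :
    ∑ a, ∑ b, ((∑ c, (dΓ c c a b - dΓ b c a c)) +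
      ∑ c, ∑ e, (Γ c e c * Γ e a b - Γ c e b * Γ e a c)) * X a * X b =
    (∑ c, ∑ a, ((E c a c + ∑ e, (dΓ c c a e * X e + Γ c a e * D e c)) * X a
        + (D c a + ∑ e, Γ c a e * X e) * D a c))
      + (∑ c, ∑ e, Γ c c e * ∑ a, (D e a + ∑ f, Γ e a f * X f) * X a)
      - (∑ c, ∑ a, (D c a + ∑ e, Γ c a e * X e) * (D a c + ∑ e, Γ a c e * X e))
      - ∑ a, X a * ∑ c, (E a c c + ∑ e, (dΓ a c c e * X e + Γ c c e * D e a)) := by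
  have e1 : ∑ c, ∑ a, E c a c * X a = ∑ a, X a * ∑ c, E a c c := by
    rw [Finset.sum_comm]
    refine Finset.sum_congr rfl fun a _ => ?_
    rw [Finset.mul_sum]
    exact Finset.sum_congr rfl fun c _ => by rw [hE, mul_comm]
  have e2 : ∑ c, ∑ a, (∑ e, Γ c a e * D e c) * X a
      = ∑ c, ∑ a, D c a * ∑ e, Γ a c e * X e := by
    -- both sides are the trace of the product of `D` with the matrix `Γ^a_{ce} X^e`
    have : ∀ c, ∑ a, (∑ e, Γ c a e * D e c) * X a
        = ∑ e, D e c * ∑ a, Γ c e a * X a := by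
      intro c
      simp only [Finset.sum_mul, Finset.mul_sum]
      rw [Finset.sum_comm]
      exact Finset.sum_congr rfl fun e _ => Finset.sum_congr rfl fun a _ => by
        rw [hΓ c a e]; ring
    rw [Finset.sum_congr rfl fun c _ => this c, Finset.sum_comm]
  have e3 : ∑ c, ∑ e, Γ c c e * ∑ a, D e a * X a
      = ∑ a, X a * ∑ c, ∑ e, Γ c c e * D e a := by
    simp only [Finset.mul_sum]
    have : ∀ c : Fin n, ∑ e, ∑ a, Γ c c e * (D e a * X a)
        = ∑ a, ∑ e, X a * (Γ c c e * D e a) := by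
      intro c
      rw [Finset.sum_comm]
      exact Finset.sum_congr rfl fun e _ => Finset.sum_congr rfl fun a _ => by ring
    rw [Finset.sum_congr rfl fun c _ => this c, Finset.sum_comm]
  have e4 : ∑ a, ∑ b, (∑ c, dΓ c c a b) * X a * X b
      = ∑ c, ∑ a, (∑ e, dΓ c c a e * X e) * X a := by
    have : ∀ a, ∑ b, (∑ c, dΓ c c a b) * X a * X b
        = ∑ c, (∑ e, dΓ c c a e * X e) * X a := by
      intro a
      simp only [Finset.sum_mul]
      rw [Finset.sum_comm]
      exact Finset.sum_congr rfl fun e _ => Finset.sum_congr rfl fun b _ => by ring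
    rw [Finset.sum_congr rfl fun a _ => this a, Finset.sum_comm]
  have e5 : ∑ a, ∑ b, (∑ c, dΓ b c a c) * X a * X b
      = ∑ a, X a * ∑ c, ∑ e, dΓ a c c e * X e := by
    rw [Finset.sum_comm]
    refine Finset.sum_congr rfl fun b _ => ?_
    simp only [Finset.sum_mul, Finset.mul_sum]
    rw [Finset.sum_comm]
    exact Finset.sum_congr rfl fun e _ => Finset.sum_congr rfl fun a _ => by
      rw [hdΓ b e a e]; ring
  have e6 : ∑ a, ∑ b, (∑ c, ∑ e, Γ c e c * Γ e a b) * X a * X b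
      = ∑ c, ∑ e, Γ c c e * ∑ a, (∑ f, Γ e a f * X f) * X a := by
    have : ∀ a b, (∑ c, ∑ e, Γ c e c * Γ e a b) * X a * X b
        = ∑ e, (∑ c, Γ c c e) * (Γ e a b * X b * X a) := by
      intro a b
      rw [Finset.sum_comm, Finset.sum_mul, Finset.sum_mul]
      refine Finset.sum_congr rfl fun e _ => ?_
      simp only [Finset.sum_mul]
      exact Finset.sum_congr rfl fun c _ => by rw [hΓ c e c]; ring
    rw [Finset.sum_congr rfl fun a _ => Finset.sum_congr rfl fun b _ => this a b]
    rw [Finset.sum_congr rfl fun a _ => Finset.sum_comm, Finset.sum_comm]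
    rw [Finset.sum_comm (f := fun c e => Γ c c e * ∑ a, (∑ f, Γ e a f * X f) * X a)]
    refine Finset.sum_congr rfl fun e _ => ?_
    rw [← Finset.sum_mul]
    simp only [← Finset.mul_sum, ← Finset.sum_mul]
  have e7 : ∑ a, ∑ b, (∑ c, ∑ e, Γ c e b * Γ e a c) * X a * X b
      = ∑ c, ∑ a, (∑ e, Γ c a e * X e) * (∑ e, Γ a c e * X e) := by
    have : ∀ a b, (∑ c, ∑ e, Γ c e b * Γ e a c) * X a * X b
        = ∑ c, ∑ e, (Γ c e b * X b) * (Γ e c a * X a) := by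
      intro a b
      simp only [Finset.sum_mul]
      exact Finset.sum_congr rfl fun c _ => Finset.sum_congr rfl fun e _ => by
        rw [hΓ e a c]; ring
    rw [Finset.sum_congr rfl fun a _ => Finset.sum_congr rfl fun b _ => this a b]
    rw [Finset.sum_congr rfl fun a _ => Finset.sum_comm, Finset.sum_comm]
    refine Finset.sum_congr rfl fun c _ => ?_
    rw [Finset.sum_congr rfl fun a _ => Finset.sum_comm, Finset.sum_comm]
    refine Finset.sum_congr rfl fun e _ => ?_
    rw [Finset.sum_mul_sum, Finset.sum_comm]
  have e8 : ∑ c, ∑ a, (∑ e, Γ c a e * X e) * D a c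
      = ∑ c, ∑ a, D c a * ∑ e, Γ a c e * X e := by
    rw [Finset.sum_comm]
    exact Finset.sum_congr rfl fun c _ => Finset.sum_congr rfl fun a _ => mul_comm _ _
  simp only [Finset.sum_add_distrib, Finset.sum_sub_distrib, add_mul, sub_mul, mul_add] at *
  rw [e1, e2, e3, e4, e5, e6, e7, e8]
  ring

/-- The Bochner (Raychaudhuri) identity: for a symmetric connection,
`R_{ab} X^a X^b = ∇_c (X^a ∇_a X^c) - (∇_a X^c)(∇_c X^a) - X^a ∂_a (∇_c X^c)`. -/
theorem connRicci_apply_apply (Γ : Fin n → Fin n → Fin n → Scalar n) (X : Field n) (x : Pt n)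
    (hΓ : ∀ a b c, DifferentiableAt ℝ (Γ a b c) x)
    (hsymm : ∀ a b c, Γ a b c =ᶠ[𝓝 x] Γ a c b)
    (hX : ∀ a, ContDiffAt ℝ ∞ (fun y => X y a) x) :
    ∑ a, ∑ b, connRicci Γ a b x * X x a * X x b =
      (∑ c, pd c (fun y => (covVec Γ X y *ᵥ X y) c) x)
        + (∑ c, ∑ e, Γ c c e x * (covVec Γ X x *ᵥ X x) e)
        - trace (covVec Γ X x * covVec Γ X x)
        - ∑ a, X x a * pd a (fun y => trace (covVec Γ X y)) x := by
  have hdX : ∀ a c, DifferentiableAt ℝ (pd a (fun y => X y c)) x := fun a c =>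
    (contDiffAt_pd a (hX c)).diffAt
  have hXd : ∀ c, DifferentiableAt ℝ (fun y => X y c) x := fun c => (hX c).diffAt
  have hG : ∀ c a e, DifferentiableAt ℝ (fun y => Γ c a e y * X y e) x := fun c a e =>
    (hΓ c a e).mul (hXd e)
  have hdN : ∀ c a, DifferentiableAt ℝ (fun y => covVec Γ X y c a) x := by
    intro c a
    refine (hdX a c).add (DifferentiableAt.fun_sum fun e _ => hG c a e)
  have hpN : ∀ d c a, pd d (fun y => covVec Γ X y c a) x
      = pd d (pd a (fun y => X y c)) x
        + ∑ e, (pd d (Γ c a e) x * X x e + Γ c a e x * pd d (fun y => X y e) x) := by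
    intro d c a
    simp only [covVec, of_apply]
    rw [pd_add d (hdX a c) (DifferentiableAt.fun_sum fun e _ => hG c a e),
      pd_sum d (fun e _ => hG c a e)]
    congr 1
    exact Finset.sum_congr rfl fun e _ => pd_mul d (hΓ c a e) (hXd e)
  have h1 : ∀ c, pd c (fun y => (covVec Γ X y *ᵥ X y) c) x
      = ∑ a, (pd c (fun y => covVec Γ X y c a) x * X x a
        + covVec Γ X x c a * pd c (fun y => X y a) x) := by
    intro c
    simp only [mulVec, dotProduct]
    have hNX : ∀ a, DifferentiableAt ℝ (fun y => covVec Γ X y c a * X y a) x := fun a =>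
      (hdN c a).mul (hXd a)
    rw [pd_sum c (fun a _ => hNX a)]
    exact Finset.sum_congr rfl fun a _ => pd_mul c (hdN c a) (hXd a)
  have h2 : ∀ a, pd a (fun y => trace (covVec Γ X y)) x
      = ∑ c, pd a (fun y => covVec Γ X y c c) x := by
    intro a
    simp only [trace, diag_apply]
    exact pd_sum a (fun c _ => hdN c c)
  simp only [h1, h2, hpN]
  simp only [connRicci, trace, diag_apply, mul_apply, mulVec, dotProduct, covVec, of_apply]
  exact bochner_algebra (X x) (fun c a => pd a (fun y => X y c) x)
    (fun d a c => pd d (pd a (fun y => X y c)) x) (fun a b c => Γ a b c x)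
    (fun d a b c => pd d (Γ a b c) x) (fun a b c => pd_comm a b (hX c))
    (fun a b c => (hsymm a b c).eq_of_nhds) (fun d a b c => pd_congr d (hsymm a b c))

/-! ### Pointwise algebra of an extended Kerr–Schild metric -/

/-- The algebraic data of an extended Kerr–Schild metric at one point: the background metric `gb`,
the full metric `g`, its inverse `gi`, the one-forms `k`, `m` and the vectors `X = k^♯`,
`M = m^♯`, both raised with `g`. -/
structure KSPoint (gb g gi : Matrix (Fin n) (Fin n) ℝ) (H K : ℝ) (k m X M : Fin n → ℝ) :
    Prop where
  metric : g = gb - (2 * H) • vecMulVec k k - K • (vecMulVec k m + vecMulVec m k)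
  inv_mul : gi * g = 1
  raise_k : gi *ᵥ k = X
  raise_m : gi *ᵥ m = M
  symm : gi.IsSymm
  kX : k ⬝ᵥ X = 0
  mX : m ⬝ᵥ X = 0
  mM : m ⬝ᵥ M = 1

namespace KSPoint

variable {gb g gi N B : Matrix (Fin n) (Fin n) ℝ} {H K : ℝ} {k m X M w l : Fin n → ℝ}

theorem dot_raise (h : KSPoint gb g gi H K k m X M) (u v : Fin n → ℝ) :
    u ⬝ᵥ gi *ᵥ v = v ⬝ᵥ gi *ᵥ u := by
  rw [dotProduct_mulVec, ← mulVec_transpose, h.symm.eq, dotProduct_comm]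

theorem k_raise (h : KSPoint gb g gi H K k m X M) (u : Fin n → ℝ) :
    k ⬝ᵥ gi *ᵥ u = u ⬝ᵥ X := by
  rw [h.dot_raise, h.raise_k]

theorem m_raise (h : KSPoint gb g gi H K k m X M) (u : Fin n → ℝ) :
    m ⬝ᵥ gi *ᵥ u = u ⬝ᵥ M := by
  rw [h.dot_raise, h.raise_m]

theorem kM (h : KSPoint gb g gi H K k m X M) : k ⬝ᵥ M = 0 := by
  rw [← h.raise_m, h.k_raise, h.mX]

theorem inv_mul_background (h : KSPoint gb g gi H K k m X M) :
    gi * gb = 1 + (2 * H) • vecMulVec X k + K • (vecMulVec X m + vecMulVec M k) := by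
  have : gb = g + (2 * H) • vecMulVec k k + K • (vecMulVec k m + vecMulVec m k) := by
    rw [h.metric]; abel
  rw [this, mul_add, mul_add, h.inv_mul, Matrix.mul_smul, Matrix.mul_smul, mul_add,
    mul_vecMulVec, mul_vecMulVec, mul_vecMulVec, h.raise_k, h.raise_m]

theorem trace_inv_mul_background (h : KSPoint gb g gi H K k m X M) :
    trace (gi * gb) = n := by
  rw [h.inv_mul_background]
  simp [trace_add, trace_smul, trace_vecMulVec, dotProduct_comm X, dotProduct_comm M, h.kX, h.mX,
    h.kM]

/-- The trace of a derivative of the metric only sees the background, because the Kerr–Schild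
part is traceless to first order. -/
theorem trace_inv_mul_deriv (h : KSPoint gb g gi H K k m X M) {c H' K' : ℝ} {k' m' : Fin n → ℝ}
    (hk : k' ⬝ᵥ X = 0) (hm : m' ⬝ᵥ X + k' ⬝ᵥ M = 0) :
    trace (gi * (c • gb - (2 * H') • vecMulVec k k - (2 * H) • (vecMulVec k' k + vecMulVec k k')
      - K' • (vecMulVec k m + vecMulVec m k)
      - K • (vecMulVec k' m + vecMulVec k m' + (vecMulVec m' k + vecMulVec m k')))) = c * n := by
  simp only [mul_sub, mul_add, Matrix.mul_smul, trace_sub, trace_add, trace_smul, mul_vecMulVec,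
    trace_vecMulVec, h.trace_inv_mul_background, smul_eq_mul, h.raise_k, h.raise_m,
    dotProduct_comm (gi *ᵥ _), h.k_raise, h.m_raise, dotProduct_comm X, dotProduct_comm M, hk, h.kX,
    h.mX, h.kM]
  linear_combination (-2 * K) * hm

/-- The covariant derivative `N` of `X` in the full metric, in terms of the covariant derivative
`B` of `X` in the background. Here `w = ℒ_X k`, `l = ℒ_X m`, `H' = X(H)` and `K' = X(K)`. -/
theorem covVec_eq (h : KSPoint gb g gi H K k m X M) {H' K' : ℝ}
    (hkB : k ᵥ* B = 0)
    (hN : g * N = gb * B + (1 / 2 : ℝ) • (-(2 * H') • vecMulVec k k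
      - (2 * H) • (vecMulVec w k + vecMulVec k w) - K' • (vecMulVec k m + vecMulVec m k)
      - K • (vecMulVec w m + vecMulVec k l + (vecMulVec l k + vecMulVec m w)))) :
    N = B + (vecMulVec X (K • (m ᵥ* B) - H' • k - H • w - (K' / 2) • m - (K / 2) • l)
      + vecMulVec (gi *ᵥ w) (-(H • k) - (K / 2) • m)
      + vecMulVec M (-((K' / 2) • k) - (K / 2) • w) + vecMulVec (gi *ᵥ l) (-(K / 2) • k)) := by
  have h1 : N = gi * (g * N) := by rw [← mul_assoc, h.inv_mul, one_mul]
  rw [h1, hN, mul_add, ← mul_assoc, h.inv_mul_background]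
  simp only [add_mul, mul_sub, mul_add, Matrix.mul_smul, Matrix.smul_mul, mul_vecMulVec,
    vecMulVec_mul, hkB, h.raise_k, h.raise_m, one_mul]
  ext a b
  simp only [Matrix.add_apply, Matrix.sub_apply, Matrix.smul_apply, vecMulVec_apply, Pi.sub_apply,
    Pi.smul_apply, Pi.neg_apply, smul_eq_mul, Pi.zero_apply]
  ring

theorem m_dot_acceleration (h : KSPoint gb g gi H K k m X M) {μ : ℝ} {W : Fin n → ℝ}
    (hwM : w ⬝ᵥ M = μ) (hw : gi *ᵥ w = W + (K * μ) • X) : m ⬝ᵥ W = μ := by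
  have := h.m_raise w
  rw [hw, dotProduct_add, dotProduct_smul, h.mX, hwM] at this
  simpa using this

section Consequences

variable {H' K' μ : ℝ}
    (h : KSPoint gb g gi H K k m X M) (hkB : k ᵥ* B = 0)
    (hN : g * N = gb * B + (1 / 2 : ℝ) • (-(2 * H') • vecMulVec k k
      - (2 * H) • (vecMulVec w k + vecMulVec k w) - K' • (vecMulVec k m + vecMulVec m k)
      - K • (vecMulVec w m + vecMulVec k l + (vecMulVec l k + vecMulVec m w))))
    (hwX : w ⬝ᵥ X = 0) (hlX : l ⬝ᵥ X = 0) (hwM : w ⬝ᵥ M = μ)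
    {W : Fin n → ℝ} (hBX : B *ᵥ X = W) (hw : gi *ᵥ w = W + (K * μ) • X)

include h hkB hN

/-- The Kerr–Schild vector is null also for the full metric, so that `k_b ∇_a k^b = 0`. -/
theorem k_vecMul_covVec (hwX : w ⬝ᵥ X = 0) (hlX : l ⬝ᵥ X = 0) : k ᵥ* N = 0 := by
  rw [h.covVec_eq hkB hN]
  simp only [vecMul_add, vecMul_vecMulVec, hkB, h.kX, h.k_raise, hwX, hlX, h.kM, zero_smul,
    add_zero]

include hwX hlX hwM hBX hw

theorem covVec_mulVec : N *ᵥ X = W + (K * μ) • X := by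
  have hmW := h.m_dot_acceleration hwM hw
  rw [h.covVec_eq hkB hN]
  simp only [add_mulVec, hBX, vecMulVec_mulVec, sub_dotProduct, smul_dotProduct, neg_dotProduct,
    h.kX, h.mX, hwX, hlX, ← dotProduct_mulVec, hmW]
  ext a
  simp
  ring

theorem trace_covVec : trace N = trace B := by
  have hmW := h.m_dot_acceleration hwM hw
  rw [h.covVec_eq hkB hN]
  simp only [trace_add, trace_vecMulVec, sub_dotProduct, smul_dotProduct, neg_dotProduct,
    dotProduct_comm X, dotProduct_comm M, dotProduct_comm (gi *ᵥ _), h.k_raise, h.m_raise,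
    h.kX, h.mX, hwX, hlX, hwM, ← dotProduct_mulVec, hBX, hmW, h.kM, smul_eq_mul]
  ring

/-- `N - B` is a sum of four rank-one matrices whose factors lie in the span of `k`, `m`, `w`, `l`
and `m B`; since `k` is null and orthogonal to `m`, `w` and `l`, few of the products have a trace. -/
theorem trace_covVec_sq : trace (N * N) = trace (B * B)
    + (K * (m ⬝ᵥ B *ᵥ W - w ⬝ᵥ B *ᵥ M - l ⬝ᵥ W) - 2 * H * (w ⬝ᵥ W) - K' * μ
      + (1 / 2) * K ^ 2 * (μ ^ 2 + w ⬝ᵥ W)) := by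
  have hmW := h.m_dot_acceleration hwM hw
  have hkW : k ⬝ᵥ W = 0 := by
    have := h.k_raise w
    rw [hw, dotProduct_add, dotProduct_smul, h.kX, hwX] at this
    simpa using this
  have hkB' : ∀ u, k ⬝ᵥ B *ᵥ u = 0 := fun u => by rw [dotProduct_mulVec, hkB, zero_dotProduct]
  have e1 : ∀ Z : Matrix (Fin n) (Fin n) ℝ,
      trace ((B + Z) * (B + Z)) = trace (B * B) + 2 * trace (B * Z) + trace (Z * Z) := by
    intro Z
    rw [add_mul, mul_add, mul_add, trace_add, trace_add, trace_add, trace_mul_comm Z B]; ring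
  obtain ⟨Z, hZ⟩ : ∃ Z, Z = vecMulVec X
        (K • (m ᵥ* B) - H' • k - H • w - (K' / 2) • m - (K / 2) • l)
      + vecMulVec (gi *ᵥ w) (-(H • k) - (K / 2) • m)
      + vecMulVec M (-((K' / 2) • k) - (K / 2) • w) + vecMulVec (gi *ᵥ l) (-(K / 2) • k) :=
    ⟨_, rfl⟩
  rw [h.covVec_eq hkB hN, ← hZ]
  have e2 : trace (B * Z) = K / 2 * (m ⬝ᵥ B *ᵥ W - w ⬝ᵥ B *ᵥ M - l ⬝ᵥ W) - H * (w ⬝ᵥ W)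
      - K' / 2 * μ - K ^ 2 / 2 * μ ^ 2 := by
    have hmBX : m ⬝ᵥ B *ᵥ X = μ := by rw [hBX, hmW]
    rw [hZ]
    simp only [mul_add, mul_vecMulVec, trace_add, trace_vecMulVec, dotProduct_comm (B *ᵥ _),
      sub_dotProduct, smul_dotProduct, neg_dotProduct, hkB', smul_eq_mul, hw, trace_smul,
      vecMulVec_smul, Matrix.mul_smul, mulVec_add,
      mulVec_smul, hBX, dotProduct_comm W, dotProduct_smul,
      add_dotProduct, dotProduct_sub, dotProduct_neg, hkW, hmW,
      ← dotProduct_mulVec]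
    ring
  have e3 : trace (Z * Z) = K ^ 2 * μ ^ 2 + K ^ 2 / 2 * (μ ^ 2 + w ⬝ᵥ W) := by
    have hww : w ⬝ᵥ gi *ᵥ w = w ⬝ᵥ W := by
      rw [hw, dotProduct_add, dotProduct_smul, hwX]; simp
    have hmBX : m ⬝ᵥ B *ᵥ X = μ := by rw [hBX, hmW]
    rw [hZ]
    simp only [mul_add, add_mul, vecMulVec_mul_vecMulVec, trace_add, trace_vecMulVec,
      trace_smul, vecMulVec_smul, Matrix.mul_smul, Matrix.smul_mul,
      sub_dotProduct, smul_dotProduct, neg_dotProduct,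
      dotProduct_comm X, dotProduct_comm M, dotProduct_comm (gi *ᵥ _),
      smul_eq_mul, h.k_raise, h.m_raise, h.kX, h.mX, h.mM, h.kM, hwX, hlX, hwM, hww,
      ← dotProduct_mulVec, hmBX]
    ring
  rw [e1, e2, e3]
  ring

end Consequences

end KSPoint

/-- The inverse of an extended Kerr–Schild metric; here `X` and `M` are `k` and `m` raised with
the background metric. -/
theorem kerrSchild_mul_inverse {gb gbi : Matrix (Fin n) (Fin n) ℝ} {H K : ℝ}
    {k m X M : Fin n → ℝ} (hgb : gb * gbi = 1) (hX : gb *ᵥ X = k) (hM : gb *ᵥ M = m)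
    (hXi : k ᵥ* gbi = X) (hMi : m ᵥ* gbi = M)
    (hkX : k ⬝ᵥ X = 0) (hkM : k ⬝ᵥ M = 0) (hmX : m ⬝ᵥ X = 0) (hmM : m ⬝ᵥ M = 1) :
    (gb - (2 * H) • vecMulVec k k - K • (vecMulVec k m + vecMulVec m k))
      * (gbi + (2 * H + K ^ 2) • vecMulVec X X + K • (vecMulVec X M + vecMulVec M X)) = 1 := by
  simp only [sub_mul, mul_add, Matrix.add_mul, Matrix.smul_mul, add_mulVec, smul_mulVec,
    vecMulVec_mulVec, Matrix.mul_smul, hgb, mul_vecMulVec,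
    vecMulVec_mul, hX, hM, hXi, hMi, hkX, hkM, hmX, hmM, zero_smul,
    one_smul, smul_zero, op_smul_eq_smul]
  ext a b
  simp only [Matrix.add_apply, Matrix.sub_apply, Matrix.smul_apply, vecMulVec_apply,
    smul_eq_mul, Pi.add_apply,
    Pi.smul_apply, Pi.zero_apply]
  ring

/-! ### Lie derivatives of rank-two tensors -/

/-- The Lie derivative `(ℒ_X S)_{da}` of a covariant tensor field of rank two. -/
noncomputable def lieTensor (X : Field n) (S : Tensor2 n) : Tensor2 n := fun x =>
  Matrix.of fun d a => ∑ c, (X x c * pd c (fun y => S y d a) x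
    + pd d (fun y => X y c) x * S x c a + pd a (fun y => X y c) x * S x d c)

theorem lieTensor_congr {X : Field n} {S T : Tensor2 n} {x : Pt n} (h : S =ᶠ[𝓝 x] T) :
    lieTensor X S x = lieTensor X T x := by
  have h0 := h.eq_of_nhds
  ext d a
  simp only [lieTensor, of_apply, h0]
  refine Finset.sum_congr rfl fun c _ => ?_
  rw [pd_congr c (h.mono fun y hy => congrFun (congrFun hy d) a :
    (fun y => S y d a) =ᶠ[𝓝 x] fun y => T y d a)]

theorem lieTensor_add {X : Field n} {S T : Tensor2 n} {x : Pt n}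
    (hS : ∀ a b, DifferentiableAt ℝ (fun y => S y a b) x)
    (hT : ∀ a b, DifferentiableAt ℝ (fun y => T y a b) x) :
    lieTensor X (fun y => S y + T y) x = lieTensor X S x + lieTensor X T x := by
  ext d a
  simp only [lieTensor, of_apply, Matrix.add_apply, ← Finset.sum_add_distrib]
  refine Finset.sum_congr rfl fun c _ => ?_
  rw [pd_add c (hS d a) (hT d a)]
  ring

theorem lieTensor_sub {X : Field n} {S T : Tensor2 n} {x : Pt n}
    (hS : ∀ a b, DifferentiableAt ℝ (fun y => S y a b) x)
    (hT : ∀ a b, DifferentiableAt ℝ (fun y => T y a b) x) :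
    lieTensor X (fun y => S y - T y) x = lieTensor X S x - lieTensor X T x := by
  ext d a
  simp only [lieTensor, of_apply, Matrix.sub_apply, ← Finset.sum_sub_distrib]
  refine Finset.sum_congr rfl fun c _ => ?_
  rw [pd_sub c (hS d a) (hT d a)]
  ring

theorem lieTensor_smul {X : Field n} {f : Scalar n} {S : Tensor2 n} {x : Pt n}
    (hf : DifferentiableAt ℝ f x) (hS : ∀ a b, DifferentiableAt ℝ (fun y => S y a b) x) :
    lieTensor X (fun y => f y • S y) x
      = (∑ c, X x c * pd c f x) • S x + f x • lieTensor X S x := by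
  ext d a
  simp only [lieTensor, of_apply, Matrix.add_apply, Matrix.smul_apply, smul_eq_mul,
    Finset.sum_mul, Finset.mul_sum, ← Finset.sum_add_distrib]
  refine Finset.sum_congr rfl fun c _ => ?_
  rw [pd_mul c hf (hS d a)]
  ring

theorem lieTensor_vecMulVec {X α β : Field n} {x : Pt n}
    (hα : ∀ a, DifferentiableAt ℝ (fun y => α y a) x)
    (hβ : ∀ a, DifferentiableAt ℝ (fun y => β y a) x) :
    lieTensor X (fun y => vecMulVec (α y) (β y)) x
      = vecMulVec (lieDeriv X α x) (β x) + vecMulVec (α x) (lieDeriv X β x) := by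
  ext d a
  simp only [lieTensor, lieDeriv, of_apply, Matrix.add_apply, vecMulVec_apply,
    Finset.sum_mul, Finset.mul_sum, ← Finset.sum_add_distrib]
  refine Finset.sum_congr rfl fun c _ => ?_
  rw [pd_mul c (hα d) (hβ a)]
  ring

/-- The symmetric part of `∇_a X_d` is half the Lie derivative of the metric and its
antisymmetric part half the exterior derivative of `k = X^♭`. The connection enters only through
the Koszul formula at the point. -/
theorem mul_covVec {g : Tensor2 n} {Γ : Fin n → Fin n → Fin n → Scalar n} {X k : Field n}
    {x : Pt n} (hg : ∀ a b, DifferentiableAt ℝ (fun y => g y a b) x)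
    (hX : ∀ a, DifferentiableAt ℝ (fun y => X y a) x)
    (hsymm : ∀ᶠ y in 𝓝 x, (g y).IsSymm)
    (hΓ : ∀ a b c, ∑ d, g x a d * Γ d b c x = (1 / 2) *
      (pd b (fun y => g y a c) x + pd c (fun y => g y a b) x - pd a (fun y => g y b c) x))
    (hk : ∀ᶠ y in 𝓝 x, g y *ᵥ X y = k y) (d a : Fin n) :
    (g x * covVec Γ X x) d a = (1 / 2) *
      (pd a (fun y => k y d) x - pd d (fun y => k y a) x + lieTensor X g x d a) := by
  have hs : ∀ u v, g x u v = g x v u := fun u v => (hsymm.self_of_nhds.apply v u)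
  have hps : ∀ c u v, pd c (fun y => g y u v) x = pd c (fun y => g y v u) x := fun c u v =>
    pd_congr c (hsymm.mono fun y hy => hy.apply v u)
  have hpk : ∀ c u, pd c (fun y => k y u) x
      = ∑ b, (pd c (fun y => g y u b) x * X x b + g x u b * pd c (fun y => X y b) x) := by
    intro c u
    have h1 : (fun y => k y u) =ᶠ[𝓝 x] fun y => ∑ b, g y u b * X y b :=
      hk.mono fun y hy => by simp only [← hy]; rfl
    have h2 : ∀ b, DifferentiableAt ℝ (fun y => g y u b * X y b) x := fun b => (hg u b).mul (hX b)
    rw [pd_congr c h1, pd_sum c fun b _ => h2 b]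
    exact Finset.sum_congr rfl fun b _ => pd_mul c (hg u b) (hX b)
  have hL : (g x * covVec Γ X x) d a = ∑ b, (g x d b * pd a (fun y => X y b) x
      + (1 / 2) * (pd a (fun y => g y d b) x + pd b (fun y => g y d a) x
        - pd d (fun y => g y a b) x) * X x b) := by
    simp only [mul_apply, covVec, of_apply, mul_add, Finset.sum_add_distrib]
    congr 1
    simp only [Finset.mul_sum, ← hΓ, Finset.sum_mul]
    rw [Finset.sum_comm]
    exact Finset.sum_congr rfl fun b _ => Finset.sum_congr rfl fun c _ => by ring
  rw [hL, hpk, hpk, lieTensor, of_apply, ← Finset.sum_sub_distrib, ← Finset.sum_add_distrib,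
    Finset.mul_sum]
  refine Finset.sum_congr rfl fun b _ => ?_
  rw [hs b a]
  ring

/-! ### The conformally flat background -/

/-- The signs of the Minkowski metric. -/
def minkSign [NeZero n] (a : Fin n) : ℝ := if a = 0 then -1 else 1

/-- The affine function `q + p_a x^a`; the backgrounds are `s⁻² η` with `s` affine. -/
def affine (p : Fin n → ℝ) (q : ℝ) : Scalar n := fun y => q + ∑ a, p a * y a

/-- The conformally flat metric `s⁻² η` with `s` affine. -/
noncomputable def confMetric [NeZero n] (p : Fin n → ℝ) (q : ℝ) : Tensor2 n :=
  fun y => (affine p q y ^ 2)⁻¹ • minkowski n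

/-- The Levi-Civita connection of `s⁻² η`, where `s` is affine with gradient `p`:
`Γ^a_{bc} = -s⁻¹ (δ^a_b p_c + δ^a_c p_b - η_{bc} p^a)`. -/
noncomputable def confConn [NeZero n] (p : Fin n → ℝ) (q : ℝ) (a b c : Fin n) : Scalar n :=
  fun y => -(affine p q y)⁻¹ * ((if a = b then p c else 0) + (if a = c then p b else 0)
    - (if b = c then minkSign b else 0) * (minkSign a * p a))

/-- Raising the index of a one-form with the metric `s⁻² η`. -/
def raiseConf [NeZero n] (p : Fin n → ℝ) (q : ℝ) (α : Field n) : Field n :=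
  fun y a => affine p q y ^ 2 * (minkSign a * α y a)

section Background

variable [NeZero n] {p : Fin n → ℝ} {q : ℝ} {x : Pt n}

theorem minkSign_mul_self (a : Fin n) : minkSign a * minkSign a = 1 := by
  unfold minkSign; split_ifs <;> norm_num

theorem minkowski_apply (a b : Fin n) : minkowski n a b = if a = b then minkSign a else 0 := by
  simp [minkowski, diagonal_apply, minkSign]

omit [NeZero n] in
theorem contDiff_affine : ContDiff ℝ ∞ (affine p q) := by
  unfold affine; fun_prop

omit [NeZero n] in
theorem pd_affine (a : Fin n) : pd a (affine p q) x = p a := by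
  have hd : ∀ b : Fin n, DifferentiableAt ℝ (fun y : Pt n => p b * y b) x := fun b => by fun_prop
  unfold affine
  rw [pd_add a (differentiableAt_const q) (DifferentiableAt.fun_sum fun b _ => hd b), pd_const,
    pd_sum a fun b _ => hd b]
  have : ∀ b, pd a (fun y : Pt n => p b * y b) x = if b = a then p b else 0 := by
    intro b
    have h0 : DifferentiableAt ℝ (fun y : Pt n => y b) x := by fun_prop
    rw [pd_const_mul a _ h0]
    have : pd a (fun y : Pt n => y b) x = if b = a then 1 else 0 := by
      unfold pd
      rw [(hasFDerivAt_apply (𝕜 := ℝ) b x).fderiv]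
      simp [Pi.single_apply]
    rw [this]; split_ifs <;> simp
  simp [this]

omit [NeZero n] in
theorem pd_inv_affine (hs : affine p q x ≠ 0) (a : Fin n) :
    pd a (fun y => (affine p q y)⁻¹) x = -(p a * (affine p q x)⁻¹ ^ 2) := by
  have hd : DifferentiableAt ℝ (affine p q) x := contDiff_affine.contDiffAt.diffAt
  have hi : DifferentiableAt ℝ (fun y => (affine p q y)⁻¹) x :=
    (contDiff_affine.contDiffAt.inv hs).diffAt
  have h1 : (fun y => affine p q y * (affine p q y)⁻¹) =ᶠ[𝓝 x] fun _ => 1 :=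
    (hd.continuousAt.eventually_ne hs).mono fun y hy => mul_inv_cancel₀ hy
  have h2 := pd_congr a h1
  rw [pd_mul a hd hi, pd_const, pd_affine] at h2
  field_simp at h2 ⊢
  linear_combination h2

theorem contDiffAt_confConn (hs : affine p q x ≠ 0) (a b c : Fin n) :
    ContDiffAt ℝ ∞ (confConn p q a b c) x := by
  unfold confConn
  exact ((contDiff_affine.contDiffAt.inv hs).neg).mul contDiffAt_const

theorem pd_confConn (hs : affine p q x ≠ 0) (d a b c : Fin n) :
    pd d (confConn p q a b c) x = -(affine p q x)⁻¹ * p d * confConn p q a b c x := by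
  have hd : DifferentiableAt ℝ (fun y => (affine p q y)⁻¹) x :=
    (contDiff_affine.contDiffAt.inv hs).diffAt
  have : confConn p q a b c = fun y => (-((if a = b then p c else 0) + (if a = c then p b else 0)
    - (if b = c then minkSign b else 0) * (minkSign a * p a))) * (affine p q y)⁻¹ := by
    funext y; unfold confConn; ring
  rw [this, pd_const_mul d _ hd, pd_inv_affine hs]
  ring

theorem confConn_symm (a b c : Fin n) : confConn p q a b c = confConn p q a c b := by
  funext y
  unfold confConn
  rw [add_comm (if a = b then p c else 0)]
  by_cases h : b = c
  · subst h; rfl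
  · rw [if_neg h, if_neg (Ne.symm h)]

theorem sum_confConn (e : Fin n) :
    ∑ c, confConn p q c c e x = -(affine p q x)⁻¹ * (n * p e) := by
  unfold confConn
  rw [← Finset.mul_sum]
  congr 1
  simp [← mul_assoc, minkSign_mul_self]

theorem sum_mul_confConn (v : Fin n → ℝ) (a b : Fin n) :
    ∑ c, v c * confConn p q c a b x = -(affine p q x)⁻¹ * (v a * p b + v b * p a
      - (if a = b then minkSign a else 0) * ∑ c, v c * (minkSign c * p c)) := by
  unfold confConn
  simp only [mul_left_comm (v _), ← Finset.mul_sum]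
  congr 1
  simp only [mul_sub, mul_add, Finset.sum_add_distrib, Finset.sum_sub_distrib, mul_ite, mul_zero,
    Finset.sum_ite_eq', Finset.mem_univ, if_true, Finset.mul_sum]
  congr 1
  exact Finset.sum_congr rfl fun c _ => by ring

/-- The metric `s⁻² η` with `s` affine is an Einstein metric. -/
theorem connRicci_confConn (hs : affine p q x ≠ 0) (a b : Fin n) :
    connRicci (confConn p q) a b x = (1 - n) * (affine p q x)⁻¹ ^ 2
      * (∑ c, minkSign c * p c ^ 2) * (if a = b then minkSign a else 0) := by
  have hP : ∑ c, p c * (minkSign c * p c) = ∑ c, minkSign c * p c ^ 2 :=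
    Finset.sum_congr rfl fun c _ => by ring
  set r := (affine p q x)⁻¹ with hr
  set P := ∑ c, minkSign c * p c ^ 2 with hPdef
  have h1 : ∑ c, pd c (confConn p q c a b) x
      = r ^ 2 * (2 * p a * p b - (if a = b then minkSign a else 0) * P) := by
    simp only [pd_confConn hs, mul_assoc, ← Finset.mul_sum]
    rw [sum_mul_confConn, hP]
    ring
  have h2 : ∑ c, pd b (confConn p q c a c) x = r ^ 2 * (n * p a * p b) := by
    simp only [pd_confConn hs, confConn_symm (p := p) (q := q) _ a, ← Finset.mul_sum]
    rw [sum_confConn]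
    ring
  have h3 : ∑ c, ∑ e, confConn p q c e c x * confConn p q e a b x
      = r ^ 2 * n * (2 * p a * p b - (if a = b then minkSign a else 0) * P) := by
    rw [Finset.sum_comm]
    simp only [← Finset.sum_mul]
    have : ∀ e, (∑ c, confConn p q c e c x) = -r * n * p e := fun e => by
      simp only [confConn_symm (p := p) (q := q) _ e, sum_confConn, ← hr]; ring
    simp only [this, mul_assoc, ← Finset.mul_sum]
    rw [sum_mul_confConn, hP]
    ring
  have h4 : ∑ c, ∑ e, confConn p q c e b x * confConn p q e a c x
      = r ^ 2 * ((n + 2) * (p a * p b) - 2 * (if a = b then minkSign a else 0) * P) := by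
    have h5 : ∀ c, ∑ e, confConn p q c e b x * confConn p q e a c x
        = -r * (p b * confConn p q c a c x
          + (if c = b then 1 else 0) * (∑ e, p e * confConn p q e a c x)
          - minkSign c * p c * (minkSign b * confConn p q b a c x)) := by
      intro c
      have : ∀ e, confConn p q c e b x * confConn p q e a c x
          = -r * ((if e = c then p b * confConn p q e a c x else 0)
            + (if c = b then 1 else 0) * (p e * confConn p q e a c x)
            - (if e = b then minkSign c * p c * (minkSign e * confConn p q e a c x) else 0)) := by
        intro e
        rw [confConn, ← hr]
        simp only [show (e = c) = (c = e) from propext eq_comm]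
        split_ifs <;> ring
      simp only [this, ← Finset.mul_sum, Finset.sum_add_distrib, Finset.sum_sub_distrib,
        Finset.sum_ite_eq', Finset.mem_univ, if_true]
    simp only [h5, ← Finset.mul_sum, Finset.sum_add_distrib, Finset.sum_sub_distrib, ite_mul,
      one_mul, zero_mul, Finset.sum_ite_eq', Finset.mem_univ, if_true]
    rw [sum_mul_confConn, hP]
    have h6 : ∑ c, confConn p q c a c x = -r * (n * p a) := by
      simp only [confConn_symm (p := p) (q := q) _ a, sum_confConn, ← hr]
    have h7 : ∑ c, minkSign c * p c * (minkSign b * confConn p q b a c x)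
        = -r * ((if a = b then minkSign a else 0) * P) := by
      have : ∀ c, minkSign c * p c * (minkSign b * confConn p q b a c x)
          = -r * ((if a = b then minkSign a else 0) * (minkSign c * p c ^ 2)
            + (if c = b then minkSign c * minkSign c * p c * p a else 0)
            - (if c = a then minkSign c * minkSign c * (minkSign b * minkSign b) * p b * p c
              else 0)) := by
        intro c
        rw [confConn, ← hr]
        clear h1 h2 h3 h5 h6
        simp only [show (b = a) = (a = b) from propext eq_comm,
          show (c = b) = (b = c) from propext eq_comm, show (c = a) = (a = c) from propext eq_comm]
        split_ifs with h1 h2 h3 h3 h2 h3 h3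
        all_goals subst_vars; ring
      simp only [this, ← Finset.mul_sum, Finset.sum_add_distrib, Finset.sum_sub_distrib,
        Finset.sum_ite_eq', Finset.mem_univ, if_true, minkSign_mul_self]
      ring
    rw [h6, h7]
    ring
  unfold connRicci
  simp only [Finset.sum_sub_distrib]
  rw [h1, h2, h3, h4]
  ring

theorem pd_confMetric (hs : affine p q x ≠ 0) (d a b : Fin n) :
    pd d (fun y => confMetric p q y a b) x
      = -2 * (affine p q x)⁻¹ * p d * confMetric p q x a b := by
  have hd : DifferentiableAt ℝ (fun y => (affine p q y)⁻¹) x :=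
    (contDiff_affine.contDiffAt.inv hs).diffAt
  have : (fun y => confMetric p q y a b)
      = fun y => minkowski n a b * ((affine p q y)⁻¹ * (affine p q y)⁻¹) := by
    funext y
    simp only [confMetric, Matrix.smul_apply, smul_eq_mul, sq, mul_inv]; ring
  have hd2 : DifferentiableAt ℝ (fun y => (affine p q y)⁻¹ * (affine p q y)⁻¹) x := hd.mul hd
  rw [this, pd_const_mul d _ hd2, pd_mul d hd hd, pd_inv_affine hs]
  simp only [confMetric, Matrix.smul_apply, smul_eq_mul, ← inv_pow]
  ring

theorem contDiffAt_confMetric (hs : affine p q x ≠ 0) (a b : Fin n) :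
    ContDiffAt ℝ ∞ (fun y => confMetric p q y a b) x :=
  ((contDiff_affine.contDiffAt.pow 2).inv (pow_ne_zero 2 hs)).mul contDiffAt_const

theorem confConn_koszul (hs : affine p q x ≠ 0) (a b c : Fin n) :
    ∑ d, confMetric p q x a d * confConn p q d b c x = (1 / 2) *
      (pd b (fun y => confMetric p q y a c) x + pd c (fun y => confMetric p q y a b) x
        - pd a (fun y => confMetric p q y b c) x) := by
  simp only [pd_confMetric hs]
  have : ∀ d, confMetric p q x a d * confConn p q d b c x
      = if d = a then (affine p q x ^ 2)⁻¹ * (minkSign a * confConn p q a b c x) else 0 := by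
    intro d
    simp only [confMetric, Matrix.smul_apply, minkowski_apply, smul_eq_mul]
    by_cases h : d = a
    · subst h; rw [if_pos rfl, if_pos rfl]; ring
    · rw [if_neg h, if_neg (Ne.symm h)]; ring
  simp only [this, Finset.sum_ite_eq', Finset.mem_univ, if_true]
  simp only [confConn, confMetric,
    Matrix.smul_apply, minkowski_apply, smul_eq_mul]
  have h1 : minkSign a * minkSign a = 1 := minkSign_mul_self a
  rw [← inv_pow]
  split_ifs
  all_goals first
    | linear_combination (0 : ℝ) * h1
    | linear_combination (affine p q x)⁻¹ ^ 3 * p a * minkSign b * h1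

theorem confMetric_mulVec_raiseConf (hs : affine p q x ≠ 0) (α : Field n) :
    confMetric p q x *ᵥ raiseConf p q α x = α x := by
  ext a
  simp only [confMetric, smul_mulVec, minkowski, mulVec_diagonal, Pi.smul_apply, smul_eq_mul,
    raiseConf]
  change (affine p q x ^ 2)⁻¹ * (minkSign a * (affine p q x ^ 2 * (minkSign a * α x a))) = _
  have h1 : minkSign a * minkSign a = 1 := minkSign_mul_self a
  field_simp
  rw [sq, h1, one_mul]

theorem confMetric_isSymm : (confMetric p q x).IsSymm := by
  unfold confMetric minkowski
  exact (isSymm_diagonal _).smul _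

end Background

/-! ### Christoffel symbols of a metric -/

/-- The Koszul formula for the Levi-Civita connection, with the upper index lowered. -/
theorem sum_mul_christoffel {g : Tensor2 n} {x : Pt n} (hg : g x * (g x)⁻¹ = 1) (a b c : Fin n) :
    ∑ d, g x a d * christoffel g d b c x = (1 / 2) *
      (pd b (fun y => g y a c) x + pd c (fun y => g y a b) x - pd a (fun y => g y b c) x) := by
  have h : ∀ v : Fin n → ℝ, g x *ᵥ ((g x)⁻¹ *ᵥ v) = v := fun v => by
    rw [mulVec_mulVec, hg, one_mulVec]
  have := congrFun (h fun d =>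
    pd b (fun y => g y d c) x + pd c (fun y => g y d b) x - pd d (fun y => g y b c) x) a
  simp only [mulVec, dotProduct] at this
  rw [← this, Finset.mul_sum]
  exact Finset.sum_congr rfl fun d _ => by unfold christoffel; ring

theorem christoffel_symm {g : Tensor2 n} {x : Pt n} (hsymm : ∀ᶠ y in 𝓝 x, (g y).IsSymm)
    (a b c : Fin n) : christoffel g a b c x = christoffel g a c b x := by
  unfold christoffel
  congr 1
  refine Finset.sum_congr rfl fun d _ => ?_
  rw [pd_congr d (hsymm.mono fun y hy => hy.apply c b :
    (fun y => g y b c) =ᶠ[𝓝 x] fun y => g y c b)]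
  ring

theorem sum_christoffel {g : Tensor2 n} {x : Pt n} (hinv : (g x)⁻¹.IsSymm) (e : Fin n) :
    ∑ c, christoffel g c c e x
      = (1 / 2) * trace ((g x)⁻¹ * Matrix.of fun a b => pd e (fun y => g y a b) x) := by
  have h1 : ∑ c, ∑ d, (g x)⁻¹ c d * pd d (fun y => g y c e) x
      = ∑ c, ∑ d, (g x)⁻¹ c d * pd c (fun y => g y d e) x := by
    rw [Finset.sum_comm]
    exact Finset.sum_congr rfl fun c _ => Finset.sum_congr rfl fun d _ => by rw [hinv.apply]
  have h2 : ∑ c, ∑ d, (g x)⁻¹ c d * pd e (fun y => g y d c) x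
      = trace ((g x)⁻¹ * Matrix.of fun a b => pd e (fun y => g y a b) x) := by
    simp [trace, mul_apply]
  unfold christoffel
  rw [← Finset.mul_sum, ← h2]
  simp only [mul_add, mul_sub, Finset.sum_add_distrib, Finset.sum_sub_distrib, h1]
  ring

/-- If `k_c ∇_a X^c` and `k_c X^c_{,a}` vanish, the connection term drops out of `X^b k_{a;b}`. -/
theorem sum_covDeriv_mul {g : Tensor2 n} {X k : Field n} {x : Pt n}
    (hk : k x ᵥ* covVec (christoffel g) X x = 0)
    (hkX : ∀ a, ∑ b, k x b * pd a (fun y => X y b) x = 0) (a : Fin n) :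
    ∑ b, covDeriv g k a b x * X x b = ∑ b, X x b * pd b (fun y => k y a) x := by
  have h0 := congrFun hk a
  simp only [vecMul, dotProduct, covVec, of_apply, mul_add, Finset.sum_add_distrib, hkX, zero_add,
    Pi.zero_apply, Finset.mul_sum] at h0
  rw [Finset.sum_comm] at h0
  simp only [covDeriv, sub_mul, Finset.sum_sub_distrib, Finset.sum_mul]
  rw [sub_eq_iff_eq_add]
  have : ∑ b, ∑ c, christoffel g c a b x * k x c * X x b = 0 := by
    rw [← h0]
    exact Finset.sum_congr rfl fun b _ => Finset.sum_congr rfl fun c _ => by ring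
  rw [this, add_zero]
  exact Finset.sum_congr rfl fun b _ => by ring

/-! ### The background covariant derivative of the Kerr–Schild vector -/

/-- The one-form `k^b k_{a,b}`, which is the acceleration of `k` for both metrics. -/
noncomputable def accel [NeZero n] (p : Fin n → ℝ) (q : ℝ) (k : Field n) : Field n :=
  fun y a => ∑ b, raiseConf p q k y b * pd b (fun z => k z a) y

section RaiseConf

variable [NeZero n] {p : Fin n → ℝ} {q : ℝ} {x : Pt n} {k α β : Field n}

theorem contDiffAt_raiseConf (hα : ∀ a, ContDiffAt ℝ ∞ (fun y => α y a) x) (a : Fin n) :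
    ContDiffAt ℝ ∞ (fun y => raiseConf p q α y a) x :=
  (contDiff_affine.contDiffAt.pow 2).mul (contDiffAt_const.mul (hα a))

theorem contDiffAt_accel (hk : ∀ a, ContDiffAt ℝ ∞ (fun y => k y a) x) (a : Fin n) :
    ContDiffAt ℝ ∞ (fun y => accel p q k y a) x :=
  ContDiffAt.sum fun b _ => (contDiffAt_raiseConf hk b).mul (contDiffAt_pd b (hk a))

theorem dotProduct_raiseConf :
    α x ⬝ᵥ raiseConf p q β x = affine p q x ^ 2 * ∑ a, minkSign a * (α x a * β x a) := by
  simp only [dotProduct, raiseConf, Finset.mul_sum]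
  exact Finset.sum_congr rfl fun a _ => by ring

theorem dotProduct_raiseConf_comm :
    α x ⬝ᵥ raiseConf p q β x = β x ⬝ᵥ raiseConf p q α x := by
  simp only [dotProduct_raiseConf, mul_comm (α x _)]

theorem pd_raiseConf (hs : affine p q x ≠ 0) (hα : ∀ a, ContDiffAt ℝ ∞ (fun y => α y a) x)
    (a b : Fin n) : pd a (fun y => raiseConf p q α y b) x
      = 2 * (affine p q x)⁻¹ * p a * raiseConf p q α x b
        + affine p q x ^ 2 * (minkSign b * pd a (fun y => α y b) x) := by
  have hd : DifferentiableAt ℝ (affine p q) x := contDiff_affine.contDiffAt.diffAt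
  have hd2 : DifferentiableAt ℝ (fun y => affine p q y * affine p q y) x := hd.mul hd
  have hc : DifferentiableAt ℝ (fun y => minkSign b * α y b) x := (hα b).diffAt.const_mul _
  simp only [raiseConf, sq]
  rw [pd_mul a hd2 hc, pd_mul a hd hd, pd_affine, pd_const_mul a _ (hα b).diffAt]
  field_simp
  ring

/-- Differentiating the constancy of `η^{ab} α_a β_b` for two one-forms. -/
theorem pd_dotProduct_raiseConf (hα : ∀ a, ContDiffAt ℝ ∞ (fun y => α y a) x)
    (hβ : ∀ a, ContDiffAt ℝ ∞ (fun y => β y a) x)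
    (h0 : ∀ᶠ y in 𝓝 x, ∑ a, minkSign a * (α y a * β y a) = 0) (e : Fin n) :
    (∑ a, pd e (fun y => α y a) x * raiseConf p q β x a)
      + ∑ a, pd e (fun y => β y a) x * raiseConf p q α x a = 0 := by
  have hm : ∀ a, DifferentiableAt ℝ (fun y => α y a * β y a) x := fun a =>
    (hα a).diffAt.mul (hβ a).diffAt
  have hm2 : ∀ a, DifferentiableAt ℝ (fun y => minkSign a * (α y a * β y a)) x := fun a =>
    (hm a).const_mul _
  have h1 := pd_congr e (h0 : (fun y => ∑ a, minkSign a * (α y a * β y a)) =ᶠ[𝓝 x] fun _ => 0)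
  rw [pd_const, pd_sum e fun a _ => hm2 a] at h1
  simp only [pd_const_mul e _ (hm _), pd_mul e (hα _).diffAt (hβ _).diffAt] at h1
  rw [← Finset.sum_add_distrib, ← mul_zero (affine p q x ^ 2), ← h1, Finset.mul_sum]
  exact Finset.sum_congr rfl fun a _ => by unfold raiseConf; ring

theorem covVec_confConn_apply (hs : affine p q x ≠ 0)
    (hk : ∀ a, ContDiffAt ℝ ∞ (fun y => k y a) x) (b a : Fin n) :
    covVec (confConn p q) (raiseConf p q k) x b a
      = affine p q x ^ 2 * (minkSign b * pd a (fun y => k y b) x)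
        + (affine p q x)⁻¹ * (p a * raiseConf p q k x b
          - (if b = a then ∑ c, p c * raiseConf p q k x c else 0)
          + minkSign a * raiseConf p q k x a * (minkSign b * p b)) := by
  have h : ∑ c, confConn p q b a c x * raiseConf p q k x c = -(affine p q x)⁻¹ *
      ((if b = a then ∑ c, p c * raiseConf p q k x c else 0) + p a * raiseConf p q k x b
        - minkSign a * raiseConf p q k x a * (minkSign b * p b)) := by
    simp only [confConn, mul_assoc, ← Finset.mul_sum]
    congr 1
    simp only [sub_mul, add_mul, ite_mul, zero_mul, Finset.sum_add_distrib,
      Finset.sum_sub_distrib, Finset.sum_ite_eq, Finset.mem_univ, if_true]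
    congr 1
    · congr 1
      split_ifs <;> simp
    · ring
  rw [covVec, of_apply, h, pd_raiseConf hs hk]
  ring

theorem vecMul_covVec_confConn (hs : affine p q x ≠ 0)
    (hk : ∀ a, ContDiffAt ℝ ∞ (fun y => k y a) x)
    (h0 : ∀ᶠ y in 𝓝 x, ∑ a, minkSign a * (k y a * k y a) = 0) :
    k x ᵥ* covVec (confConn p q) (raiseConf p q k) x = 0 := by
  ext a
  have h1 := pd_dotProduct_raiseConf (p := p) (q := q) hk hk h0 a
  have h2 : ∑ b, k x b * raiseConf p q k x b = 0 := by
    have := dotProduct_raiseConf (p := p) (q := q) (α := k) (β := k) (x := x)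
    rw [h0.self_of_nhds, mul_zero] at this
    exact this
  have h3 : ∀ b, k x b * covVec (confConn p q) (raiseConf p q k) x b a
      = pd a (fun y => k y b) x * raiseConf p q k x b
        + (affine p q x)⁻¹ * (p a * (k x b * raiseConf p q k x b)
          - (if b = a then k x b * ∑ c, p c * raiseConf p q k x c else 0)
          + k x a * (minkSign a * minkSign a) * (p b * raiseConf p q k x b)) := by
    intro b
    rw [covVec_confConn_apply hs hk]
    unfold raiseConf
    split_ifs <;> ring
  simp only [vecMul, dotProduct, h3, Pi.zero_apply, Finset.sum_add_distrib,
    Finset.sum_sub_distrib, ← Finset.mul_sum, h2, Finset.sum_ite_eq', Finset.mem_univ, if_true,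
    minkSign_mul_self]
  linear_combination (1 / 2) * h1

theorem covVec_confConn_mulVec (hs : affine p q x ≠ 0)
    (hk : ∀ a, ContDiffAt ℝ ∞ (fun y => k y a) x)
    (h0 : ∑ a, minkSign a * (k x a * k x a) = 0) :
    covVec (confConn p q) (raiseConf p q k) x *ᵥ raiseConf p q k x
      = raiseConf p q (accel p q k) x := by
  ext b
  have h1 : ∑ a, minkSign a * raiseConf p q k x a * raiseConf p q k x a = 0 := by
    rw [← mul_zero (affine p q x ^ 4), ← h0, Finset.mul_sum]
    refine Finset.sum_congr rfl fun a _ => ?_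
    unfold raiseConf
    linear_combination (affine p q x ^ 4 * minkSign a * k x a * k x a) * minkSign_mul_self a
  have h3 : ∀ a, covVec (confConn p q) (raiseConf p q k) x b a * raiseConf p q k x a
      = affine p q x ^ 2 * (minkSign b * (raiseConf p q k x a * pd a (fun y => k y b) x))
        + (affine p q x)⁻¹ * (raiseConf p q k x b * (p a * raiseConf p q k x a)
          - (if b = a then raiseConf p q k x a * ∑ c, p c * raiseConf p q k x c else 0)
          + (minkSign b * p b) * (minkSign a * raiseConf p q k x a * raiseConf p q k x a)) := by
    intro a
    rw [covVec_confConn_apply hs hk]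
    split_ifs <;> ring
  simp only [mulVec, dotProduct, h3, Finset.sum_add_distrib, Finset.sum_sub_distrib,
    ← Finset.mul_sum, h1, Finset.sum_ite_eq, Finset.mem_univ, if_true]
  have h4 : raiseConf p q (accel p q k) x b = affine p q x ^ 2 * (minkSign b
      * ∑ a, raiseConf p q k x a * pd a (fun y => k y b) x) := rfl
  rw [h4]
  ring

/-- The antisymmetric part of `∇_a k_d` is the exterior derivative of `k`. -/
theorem confMetric_mul_covVec_sub (hs : affine p q x ≠ 0)
    (hk : ∀ a, ContDiffAt ℝ ∞ (fun y => k y a) x) (d a : Fin n) :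
    (confMetric p q x * covVec (confConn p q) (raiseConf p q k) x) d a
      - (confMetric p q x * covVec (confConn p q) (raiseConf p q k) x) a d
      = pd a (fun y => k y d) x - pd d (fun y => k y a) x := by
  have h : ∀ u v, (confMetric p q x * covVec (confConn p q) (raiseConf p q k) x) u v
      = pd v (fun y => k y u) x + (affine p q x)⁻¹ * (p v * k x u + k x v * p u)
        - (affine p q x)⁻¹ * (affine p q x ^ 2)⁻¹
          * (if u = v then minkSign u * ∑ c, p c * raiseConf p q k x c else 0) := by
    intro u v
    have h1 : minkSign u * minkSign u = 1 := minkSign_mul_self u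
    have h2 : minkSign v * minkSign v = 1 := minkSign_mul_self v
    have h3 : (confMetric p q x * covVec (confConn p q) (raiseConf p q k) x) u v
        = (affine p q x ^ 2)⁻¹
          * (minkSign u * covVec (confConn p q) (raiseConf p q k) x u v) := by
      simp only [confMetric, Matrix.smul_mul, Matrix.smul_apply, smul_eq_mul, minkowski,
        diagonal_mul, minkSign]
    rw [h3, covVec_confConn_apply hs hk]
    generalize ∑ c, p c * raiseConf p q k x c = S
    unfold raiseConf
    field_simp
    split_ifs
    all_goals linear_combination (affine p q x ^ 3 * pd v (fun y => k y u) x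
        + affine p q x ^ 2 * p v * k x u + affine p q x ^ 2 * k x v * p u * minkSign v ^ 2) * h1
        + (affine p q x ^ 2 * k x v * p u) * h2
  rw [h, h]
  by_cases hda : d = a
  · subst hda; ring
  · rw [if_neg hda, if_neg (Ne.symm hda)]; ring

end RaiseConf

/-! ### Extended Kerr–Schild metrics over a conformally flat background -/

/-- An extended Kerr–Schild metric over the background `s⁻² η`, with `s` affine. The conditions on
`k` and `m` are expressed with the background metric; `raiseConf p q k` is `k^a`, and
`raiseConf p q m` is `m^a - K k^a`. -/
structure KSChart [NeZero n] (U : Set (Pt n)) (p : Fin n → ℝ) (q : ℝ) (g : Tensor2 n)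
    (H K : Scalar n) (k m : Field n) : Prop where
  isOpen : IsOpen U
  ne : ∀ x ∈ U, affine p q x ≠ 0
  smooth_H : ∀ x ∈ U, ContDiffAt ℝ ∞ H x
  smooth_K : ∀ x ∈ U, ContDiffAt ℝ ∞ K x
  smooth_k : ∀ x ∈ U, ∀ a, ContDiffAt ℝ ∞ (fun y => k y a) x
  smooth_m : ∀ x ∈ U, ∀ a, ContDiffAt ℝ ∞ (fun y => m y a) x
  metric_eq : ∀ x ∈ U, g x = confMetric p q x - (2 * H x) • vecMulVec (k x) (k x)
    - K x • (vecMulVec (k x) (m x) + vecMulVec (m x) (k x))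
  null : ∀ x ∈ U, ∑ a, minkSign a * (k x a * k x a) = 0
  orth : ∀ x ∈ U, ∑ a, minkSign a * (k x a * m x a) = 0
  unit : ∀ x ∈ U, m x ⬝ᵥ raiseConf p q m x = 1

/-- The inverse of an extended Kerr–Schild metric. -/
noncomputable def ksInv [NeZero n] (p : Fin n → ℝ) (q : ℝ) (H K : Scalar n) (k m : Field n) :
    Tensor2 n := fun x => affine p q x ^ 2 • minkowski n
      + (2 * H x + K x ^ 2) • vecMulVec (raiseConf p q k x) (raiseConf p q k x)
      + K x • (vecMulVec (raiseConf p q k x) (raiseConf p q m x)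
        + vecMulVec (raiseConf p q m x) (raiseConf p q k x))

/-- The vector `m^a = g^{ab} m_b`, raised with the full metric. -/
noncomputable def raiseM [NeZero n] (p : Fin n → ℝ) (q : ℝ) (K : Scalar n) (k m : Field n) :
    Field n := fun y a => raiseConf p q m y a + K y * raiseConf p q k y a

/-- The component `m^a k^b k_{a,b}` of the acceleration of `k` along `m`. -/
noncomputable def accelM [NeZero n] (p : Fin n → ℝ) (q : ℝ) (k m : Field n) : Scalar n :=
  fun y => accel p q k y ⬝ᵥ raiseConf p q m y

namespace KSChart

variable [NeZero n] {U : Set (Pt n)} {p : Fin n → ℝ} {q : ℝ} {g : Tensor2 n}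
  {H K : Scalar n} {k m : Field n} {x : Pt n}

theorem kX (h : KSChart U p q g H K k m) (hx : x ∈ U) : k x ⬝ᵥ raiseConf p q k x = 0 := by
  rw [dotProduct_raiseConf, h.null x hx, mul_zero]

theorem kM (h : KSChart U p q g H K k m) (hx : x ∈ U) : k x ⬝ᵥ raiseConf p q m x = 0 := by
  rw [dotProduct_raiseConf, h.orth x hx, mul_zero]

theorem mX (h : KSChart U p q g H K k m) (hx : x ∈ U) : m x ⬝ᵥ raiseConf p q k x = 0 := by
  rw [dotProduct_raiseConf_comm, h.kM hx]

theorem mul_ksInv (h : KSChart U p q g H K k m) (hx : x ∈ U) :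
    g x * ksInv p q H K k m x = 1 := by
  have hs := h.ne x hx
  have hη : ∀ α : Field n, α x ᵥ* (affine p q x ^ 2 • minkowski n) = raiseConf p q α x := by
    intro α
    ext a
    simp only [vecMul_smul, minkowski, vecMul_diagonal, Pi.smul_apply, smul_eq_mul, raiseConf,
      minkSign]
    ring
  have hηη : confMetric p q x * (affine p q x ^ 2 • minkowski n) = 1 := by
    rw [confMetric, Matrix.smul_mul, Matrix.mul_smul, smul_smul,
      inv_mul_cancel₀ (pow_ne_zero 2 hs), one_smul, minkowski, diagonal_mul_diagonal,
      ← diagonal_one]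
    congr 1
    funext a
    exact minkSign_mul_self a
  rw [h.metric_eq x hx]
  exact kerrSchild_mul_inverse hηη (confMetric_mulVec_raiseConf hs k)
    (confMetric_mulVec_raiseConf hs m) (hη k) (hη m) (h.kX hx) (h.kM hx) (h.mX hx) (h.unit x hx)

theorem inv_eq (h : KSChart U p q g H K k m) (hx : x ∈ U) :
    (g x)⁻¹ = ksInv p q H K k m x :=
  inv_eq_right_inv (h.mul_ksInv hx)

theorem ksInv_mulVec_k (h : KSChart U p q g H K k m) (hx : x ∈ U) :
    ksInv p q H K k m x *ᵥ k x = raiseConf p q k x := by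
  have h1 : (affine p q x ^ 2 • minkowski n) *ᵥ k x = raiseConf p q k x := by
    ext a; simp only [smul_mulVec, minkowski, mulVec_diagonal, Pi.smul_apply, smul_eq_mul]; rfl
  simp only [ksInv, add_mulVec, smul_mulVec, vecMulVec_mulVec, h1, dotProduct_comm _ (k x),
    h.kX hx, h.kM hx, op_smul_eq_smul, zero_smul, smul_zero, add_zero]

theorem ksInv_mulVec {α : Field n}
    (hα : α x ⬝ᵥ raiseConf p q k x = 0) :
    ksInv p q H K k m x *ᵥ α x
      = raiseConf p q α x + (K x * (α x ⬝ᵥ raiseConf p q m x)) • raiseConf p q k x := by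
  have h1 : (affine p q x ^ 2 • minkowski n) *ᵥ α x = raiseConf p q α x := by
    ext a; simp only [smul_mulVec, minkowski, mulVec_diagonal, Pi.smul_apply, smul_eq_mul]; rfl
  simp only [ksInv, add_mulVec, smul_mulVec, vecMulVec_mulVec, h1, dotProduct_comm _ (α x),
    hα, op_smul_eq_smul, zero_smul, smul_zero, add_zero, smul_smul]

theorem raise_k (h : KSChart U p q g H K k m) (hx : x ∈ U) :
    raise g k x = raiseConf p q k x := by
  rw [← h.ksInv_mulVec_k hx, ← h.inv_eq hx]; rfl

theorem raise_m (h : KSChart U p q g H K k m) (hx : x ∈ U) :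
    raise g m x = raiseM p q K k m x := by
  have h1 := ksInv_mulVec (H := H) (K := K) (m := m) (h.mX hx)
  rw [h.unit x hx, ← h.inv_eq hx, mul_one] at h1
  exact h1

theorem ksPoint (h : KSChart U p q g H K k m) (hx : x ∈ U) :
    KSPoint (confMetric p q x) (g x) (g x)⁻¹ (H x) (K x) (k x) (m x) (raiseConf p q k x)
      (raiseM p q K k m x) where
  metric := h.metric_eq x hx
  inv_mul := by rw [h.inv_eq hx]; exact mul_eq_one_comm.1 (h.mul_ksInv hx)
  raise_k := h.raise_k hx
  raise_m := h.raise_m hx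
  symm := by
    rw [h.inv_eq hx]
    ext a b
    simp only [ksInv, transpose_apply, Matrix.add_apply, Matrix.smul_apply, vecMulVec_apply,
      smul_eq_mul, minkowski_apply]
    by_cases hab : a = b
    · subst hab; rfl
    · rw [if_neg hab, if_neg (Ne.symm hab)]; ring
  kX := h.kX hx
  mX := h.mX hx
  mM := by
    change m x ⬝ᵥ (raiseConf p q m x + K x • raiseConf p q k x) = 1
    rw [dotProduct_add, dotProduct_smul, h.mX hx, h.unit x hx, smul_zero, add_zero]

theorem isSymm (h : KSChart U p q g H K k m) (hx : x ∈ U) : (g x).IsSymm := by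
  rw [h.metric_eq x hx]
  ext a b
  simp only [transpose_apply, Matrix.add_apply, Matrix.sub_apply, Matrix.smul_apply,
    vecMulVec_apply, smul_eq_mul, confMetric_isSymm.apply b a]
  ring

theorem eventually_mem (h : KSChart U p q g H K k m) (hx : x ∈ U) : ∀ᶠ y in 𝓝 x, y ∈ U :=
  h.isOpen.mem_nhds hx

theorem contDiffAt_metric (h : KSChart U p q g H K k m) (hx : x ∈ U) (a b : Fin n) :
    ContDiffAt ℝ ∞ (fun y => g y a b) x := by
  have h1 : ContDiffAt ℝ ∞ (fun y => confMetric p q y a b - 2 * H y * (k y a * k y b)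
      - K y * (k y a * m y b + m y a * k y b)) x :=
    ((contDiffAt_confMetric (h.ne x hx) a b).sub ((contDiffAt_const.mul (h.smooth_H x hx)).mul
      ((h.smooth_k x hx a).mul (h.smooth_k x hx b)))).sub ((h.smooth_K x hx).mul
      (((h.smooth_k x hx a).mul (h.smooth_m x hx b)).add
        ((h.smooth_m x hx a).mul (h.smooth_k x hx b))))
  refine h1.congr_of_eventuallyEq ((h.eventually_mem hx).mono fun y hy => ?_)
  simp only [h.metric_eq y hy, Matrix.add_apply, Matrix.sub_apply, Matrix.smul_apply,
    vecMulVec_apply, smul_eq_mul]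

theorem contDiffAt_inv (h : KSChart U p q g H K k m) (hx : x ∈ U) (a b : Fin n) :
    ContDiffAt ℝ ∞ (fun y => (g y)⁻¹ a b) x := by
  have hX := contDiffAt_raiseConf (p := p) (q := q) (h.smooth_k x hx)
  have hM := contDiffAt_raiseConf (p := p) (q := q) (h.smooth_m x hx)
  have h1 : ContDiffAt ℝ ∞ (fun y => affine p q y ^ 2 * minkowski n a b
      + (2 * H y + K y ^ 2) * (raiseConf p q k y a * raiseConf p q k y b)
      + K y * (raiseConf p q k y a * raiseConf p q m y b
        + raiseConf p q m y a * raiseConf p q k y b)) x :=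
    (((contDiff_affine.contDiffAt.pow 2).mul contDiffAt_const).add
      (((contDiffAt_const.mul (h.smooth_H x hx)).add ((h.smooth_K x hx).pow 2)).mul
        ((hX a).mul (hX b)))).add ((h.smooth_K x hx).mul
      (((hX a).mul (hM b)).add ((hM a).mul (hX b))))
  refine h1.congr_of_eventuallyEq ((h.eventually_mem hx).mono fun y hy => ?_)
  simp only [h.inv_eq hy, ksInv, Matrix.add_apply, Matrix.smul_apply, vecMulVec_apply, smul_eq_mul]

theorem contDiffAt_christoffel (h : KSChart U p q g H K k m) (hx : x ∈ U) (a b c : Fin n) :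
    ContDiffAt ℝ ∞ (christoffel g a b c) x :=
  contDiffAt_const.mul (ContDiffAt.sum fun d _ => (h.contDiffAt_inv hx a d).mul
    (((contDiffAt_pd b (h.contDiffAt_metric hx d c)).add
      (contDiffAt_pd c (h.contDiffAt_metric hx d b))).sub
        (contDiffAt_pd d (h.contDiffAt_metric hx b c))))

theorem eventually_isSymm (h : KSChart U p q g H K k m) (hx : x ∈ U) :
    ∀ᶠ y in 𝓝 x, (g y).IsSymm :=
  (h.eventually_mem hx).mono fun _ hy => h.isSymm hy

/-- The identity `k^b k_{b,a} = 0`. -/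
theorem pd_k_dot_X (h : KSChart U p q g H K k m) (hx : x ∈ U) (a : Fin n) :
    ∑ b, pd a (fun y => k y b) x * raiseConf p q k x b = 0 := by
  have := pd_dotProduct_raiseConf (p := p) (q := q) (h.smooth_k x hx) (h.smooth_k x hx)
    ((h.eventually_mem hx).mono h.null) a
  linarith

theorem pd_k_dot_M (h : KSChart U p q g H K k m) (hx : x ∈ U) (a : Fin n) :
    (∑ b, pd a (fun y => k y b) x * raiseConf p q m x b)
      + ∑ b, pd a (fun y => m y b) x * raiseConf p q k x b = 0 :=
  pd_dotProduct_raiseConf (h.smooth_k x hx) (h.smooth_m x hx)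
    ((h.eventually_mem hx).mono h.orth) a

omit [NeZero n] in
/-- If `α_b Y^b` vanishes near `x`, the Leibniz rule moves a derivative from `Y` to `α`. -/
theorem sum_pd_mul_eq_neg {α Y : Field n} (hα : ∀ a, ContDiffAt ℝ ∞ (fun y => α y a) x)
    (hY : ∀ a, ContDiffAt ℝ ∞ (fun y => Y y a) x) (h0 : ∀ᶠ y in 𝓝 x, α y ⬝ᵥ Y y = 0)
    (a : Fin n) :
    ∑ b, pd a (fun y => Y y b) x * α x b = -∑ b, pd a (fun y => α y b) x * Y x b := by
  have hm : ∀ b, DifferentiableAt ℝ (fun y => α y b * Y y b) x := fun b =>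
    (hα b).diffAt.mul (hY b).diffAt
  have h1 : pd a (fun y => ∑ b, α y b * Y y b) x = pd a (fun _ => 0) x := pd_congr a h0
  rw [pd_const, pd_sum a fun b _ => hm b] at h1
  simp only [pd_mul a (hα _).diffAt (hY _).diffAt, Finset.sum_add_distrib] at h1
  rw [eq_neg_iff_add_eq_zero, ← h1, add_comm]
  congr 1
  exact Finset.sum_congr rfl fun b _ => mul_comm _ _

theorem lieDeriv_k (h : KSChart U p q g H K k m) (hx : x ∈ U) :
    lieDeriv (raiseConf p q k) k x = accel p q k x := by
  ext a
  have h1 := sum_pd_mul_eq_neg (h.smooth_k x hx) (contDiffAt_raiseConf (h.smooth_k x hx))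
    ((h.eventually_mem hx).mono fun y hy => h.kX hy) a
  rw [h.pd_k_dot_X hx, neg_zero] at h1
  rw [lieDeriv, Finset.sum_add_distrib, h1, add_zero]
  rfl

theorem sum_k_mul_pd (h : KSChart U p q g H K k m) (hx : x ∈ U) (a : Fin n) :
    ∑ b, k x b * pd a (fun y => raiseConf p q k y b) x = 0 := by
  have h1 := sum_pd_mul_eq_neg (h.smooth_k x hx) (contDiffAt_raiseConf (h.smooth_k x hx))
    ((h.eventually_mem hx).mono fun y hy => h.kX hy) a
  rw [h.pd_k_dot_X hx, neg_zero] at h1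
  rw [← h1]
  exact Finset.sum_congr rfl fun b _ => mul_comm _ _

theorem accel_dot_X (h : KSChart U p q g H K k m) (hx : x ∈ U) :
    accel p q k x ⬝ᵥ raiseConf p q k x = 0 := by
  simp only [accel, dotProduct, Finset.sum_mul]
  rw [Finset.sum_comm]
  refine Finset.sum_eq_zero fun b _ => ?_
  simp only [mul_assoc, ← Finset.mul_sum, h.pd_k_dot_X hx, mul_zero]

theorem lieDeriv_m_dot_X (h : KSChart U p q g H K k m) (hx : x ∈ U) :
    lieDeriv (raiseConf p q k) m x ⬝ᵥ raiseConf p q k x = 0 := by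
  have h1 := fun a => sum_pd_mul_eq_neg (h.smooth_m x hx) (contDiffAt_raiseConf (h.smooth_k x hx))
    ((h.eventually_mem hx).mono fun y hy => h.mX hy) a
  simp only [lieDeriv, dotProduct, Finset.sum_add_distrib, h1, add_mul, neg_mul, Finset.sum_mul,
    Finset.sum_neg_distrib]
  rw [add_neg_eq_zero, Finset.sum_comm]
  exact Finset.sum_congr rfl fun b _ => Finset.sum_congr rfl fun a _ => by ring

theorem kM' (h : KSChart U p q g H K k m) (hx : x ∈ U) :
    k x ⬝ᵥ raiseM p q K k m x = 0 := (h.ksPoint hx).kM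

theorem contDiffAt_raiseM (h : KSChart U p q g H K k m) (hx : x ∈ U) (a : Fin n) :
    ContDiffAt ℝ ∞ (fun y => raiseM p q K k m y a) x :=
  (contDiffAt_raiseConf (h.smooth_m x hx) a).add
    ((h.smooth_K x hx).mul (contDiffAt_raiseConf (h.smooth_k x hx) a))

/-- Cartan's formula for `ℒ_m k`, since `k_a m^a = 0`. -/
theorem lieDeriv_raiseM_k (h : KSChart U p q g H K k m) (hx : x ∈ U) (v : Fin n → ℝ) :
    lieDeriv (raiseM p q K k m) k x ⬝ᵥ v = ∑ d, ∑ a, raiseM p q K k m x d * v a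
      * (pd d (fun y => k y a) x - pd a (fun y => k y d) x) := by
  have h1 := fun a => sum_pd_mul_eq_neg (h.smooth_k x hx) (h.contDiffAt_raiseM hx)
    ((h.eventually_mem hx).mono fun y hy => h.kM' hy) a
  simp only [lieDeriv, dotProduct, Finset.sum_add_distrib, h1, ← sub_eq_add_neg,
    ← Finset.sum_sub_distrib, Finset.sum_mul]
  rw [Finset.sum_comm]
  exact Finset.sum_congr rfl fun b _ => Finset.sum_congr rfl fun a _ => by ring

theorem accel_dot_raiseM (h : KSChart U p q g H K k m) (hx : x ∈ U) :
    accel p q k x ⬝ᵥ raiseM p q K k m x = accelM p q k m x := by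
  change accel p q k x ⬝ᵥ (raiseConf p q m x + K x • raiseConf p q k x) = _
  rw [dotProduct_add, dotProduct_smul, h.accel_dot_X hx, smul_zero, add_zero]
  rfl

theorem inv_mulVec_accel (h : KSChart U p q g H K k m) (hx : x ∈ U) :
    (g x)⁻¹ *ᵥ accel p q k x = raiseConf p q (accel p q k) x
      + (K x * accelM p q k m x) • raiseConf p q k x := by
  rw [h.inv_eq hx]
  exact ksInv_mulVec (H := H) (K := K) (m := m) (h.accel_dot_X hx)

/-- The Kerr–Schild terms do not change the trace of the Christoffel symbols. -/
theorem sum_christoffel_eq (h : KSChart U p q g H K k m) (hx : x ∈ U) (e : Fin n) :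
    ∑ c, christoffel g c c e x = ∑ c, confConn p q c c e x := by
  have hs := h.ne x hx
  have hP := h.ksPoint hx
  have hd : (Matrix.of fun a b => pd e (fun y => g y a b) x)
      = (-2 * (affine p q x)⁻¹ * p e) • confMetric p q x
        - (2 * pd e H x) • vecMulVec (k x) (k x)
        - (2 * H x) • (vecMulVec (fun a => pd e (fun y => k y a) x) (k x)
          + vecMulVec (k x) (fun a => pd e (fun y => k y a) x))
        - pd e K x • (vecMulVec (k x) (m x) + vecMulVec (m x) (k x))
        - K x • (vecMulVec (fun a => pd e (fun y => k y a) x) (m x)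
            + vecMulVec (k x) (fun a => pd e (fun y => m y a) x)
          + (vecMulVec (fun a => pd e (fun y => m y a) x) (k x)
            + vecMulVec (m x) (fun a => pd e (fun y => k y a) x))) := by
    ext a b
    have hH := (h.smooth_H x hx).diffAt
    have hK := (h.smooth_K x hx).diffAt
    have hk := fun a => (h.smooth_k x hx a).diffAt
    have hm := fun a => (h.smooth_m x hx a).diffAt
    have hg : (fun y => g y a b) =ᶠ[𝓝 x] fun y => confMetric p q y a b
        - 2 * (H y * (k y a * k y b)) - K y * (k y a * m y b + m y a * k y b) :=
      (h.eventually_mem hx).mono fun y hy => by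
        simp only [h.metric_eq y hy, Matrix.add_apply, Matrix.sub_apply, Matrix.smul_apply,
          vecMulVec_apply, smul_eq_mul]
        ring
    have d0 := (contDiffAt_confMetric (p := p) (q := q) hs a b).diffAt
    have d1 : DifferentiableAt ℝ (fun y => k y a * k y b) x := (hk a).mul (hk b)
    have d2 : DifferentiableAt ℝ (fun y => H y * (k y a * k y b)) x := hH.mul d1
    have d3 : DifferentiableAt ℝ (fun y => 2 * (H y * (k y a * k y b))) x := d2.const_mul 2
    have d4 : DifferentiableAt ℝ (fun y => k y a * m y b) x := (hk a).mul (hm b)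
    have d5 : DifferentiableAt ℝ (fun y => m y a * k y b) x := (hm a).mul (hk b)
    have d6 : DifferentiableAt ℝ (fun y => k y a * m y b + m y a * k y b) x := d4.add d5
    have d7 : DifferentiableAt ℝ (fun y => K y * (k y a * m y b + m y a * k y b)) x := hK.mul d6
    have d8 : DifferentiableAt ℝ (fun y => confMetric p q y a b - 2 * (H y * (k y a * k y b))) x :=
      d0.sub d3
    simp only [of_apply, Matrix.add_apply, Matrix.sub_apply, Matrix.smul_apply, vecMulVec_apply,
      smul_eq_mul]
    rw [pd_congr e hg, pd_sub e d8 d7, pd_sub e d0 d3, pd_const_mul e _ d2, pd_mul e hH d1,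
      pd_mul e (hk a) (hk b), pd_mul e hK d6, pd_add e d4 d5, pd_mul e (hk a) (hm b),
      pd_mul e (hm a) (hk b), pd_confMetric hs]
    ring
  have h1 : (fun a => pd e (fun y => k y a) x) ⬝ᵥ raiseConf p q k x = 0 := h.pd_k_dot_X hx e
  have h2 : (fun a => pd e (fun y => m y a) x) ⬝ᵥ raiseConf p q k x
      + (fun a => pd e (fun y => k y a) x) ⬝ᵥ raiseM p q K k m x = 0 := by
    change _ + (fun a => pd e (fun y => k y a) x)
      ⬝ᵥ (raiseConf p q m x + K x • raiseConf p q k x) = 0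
    rw [dotProduct_add, dotProduct_smul, h1, smul_zero, add_zero, add_comm]
    exact h.pd_k_dot_M hx e
  rw [sum_christoffel hP.symm, hd, hP.trace_inv_mul_deriv h1 h2, sum_confConn]
  ring

/-- The covariant derivatives of `k^a` in the full metric and in the background differ by half the
Lie derivative of the Kerr–Schild terms, because the exterior derivative of `k` is the same. -/
theorem metric_mul_covVec (h : KSChart U p q g H K k m) (hx : x ∈ U) :
    ∃ H' : ℝ, g x * covVec (christoffel g) (raiseConf p q k) x
      = confMetric p q x * covVec (confConn p q) (raiseConf p q k) x
        + (1 / 2 : ℝ) • (-(2 * H') • vecMulVec (k x) (k x)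
        - (2 * H x) • (vecMulVec (accel p q k x) (k x) + vecMulVec (k x) (accel p q k x))
        - (∑ c, raiseConf p q k x c * pd c K x)
          • (vecMulVec (k x) (m x) + vecMulVec (m x) (k x))
        - K x • (vecMulVec (accel p q k x) (m x)
            + vecMulVec (k x) (lieDeriv (raiseConf p q k) m x)
          + (vecMulVec (lieDeriv (raiseConf p q k) m x) (k x)
            + vecMulVec (m x) (accel p q k x)))) := by
  have hs := h.ne x hx
  have hev := h.eventually_mem hx
  have hX := fun a => (contDiffAt_raiseConf (p := p) (q := q) (h.smooth_k x hx) a).diffAt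
  have hk := fun a => (h.smooth_k x hx a).diffAt
  have hm := fun a => (h.smooth_m x hx a).diffAt
  have hK := (h.smooth_K x hx).diffAt
  have hgb := fun a b => (contDiffAt_confMetric (p := p) (q := q) hs a b).diffAt
  have hH2 : DifferentiableAt ℝ (fun y => 2 * H y) x := (h.smooth_H x hx).diffAt.const_mul 2
  have e1 : ∀ {α β : Field n}, (∀ a, DifferentiableAt ℝ (fun y => α y a) x) →
      (∀ a, DifferentiableAt ℝ (fun y => β y a) x) →
      ∀ a b, DifferentiableAt ℝ (fun y => (vecMulVec (α y) (β y)) a b) x :=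
    fun hα hβ a b => (hα a).mul (hβ b)
  have d1 : ∀ a b, DifferentiableAt ℝ (fun y => ((2 * H y) • vecMulVec (k y) (k y)) a b) x :=
    fun a b => hH2.mul (e1 hk hk a b)
  have d2 : ∀ a b, DifferentiableAt ℝ
      (fun y => (vecMulVec (k y) (m y) + vecMulVec (m y) (k y)) a b) x :=
    fun a b => (e1 hk hm a b).add (e1 hm hk a b)
  have d3 : ∀ a b, DifferentiableAt ℝ
      (fun y => (K y • (vecMulVec (k y) (m y) + vecMulVec (m y) (k y))) a b) x :=
    fun a b => hK.mul (d2 a b)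
  have d4 : ∀ a b, DifferentiableAt ℝ
      (fun y => (confMetric p q y - (2 * H y) • vecMulVec (k y) (k y)) a b) x :=
    fun a b => (hgb a b).sub (d1 a b)
  have hlie : lieTensor (raiseConf p q k) g x = _ :=
    lieTensor_congr (hev.mono h.metric_eq)
  rw [lieTensor_sub d4 d3, lieTensor_sub hgb d1, lieTensor_smul hH2 (e1 hk hk),
    lieTensor_smul hK d2, lieTensor_add (e1 hk hm) (e1 hm hk), lieTensor_vecMulVec hk hk,
    lieTensor_vecMulVec hk hm, lieTensor_vecMulVec hm hk, h.lieDeriv_k hx] at hlie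
  refine ⟨(∑ c, raiseConf p q k x c * pd c (fun y => 2 * H y) x) / 2, ?_⟩
  ext d a
  have hgX : ∀ᶠ y in 𝓝 x, g y *ᵥ raiseConf p q k y = k y := hev.mono fun y hy => by
    rw [← h.ksInv_mulVec_k hy, mulVec_mulVec, h.mul_ksInv hy, one_mulVec]
  have hgg : g x * (g x)⁻¹ = 1 := by rw [h.inv_eq hx]; exact h.mul_ksInv hx
  rw [mul_covVec (fun a b => (h.contDiffAt_metric hx a b).diffAt) hX (h.eventually_isSymm hx)
    (sum_mul_christoffel hgg) hgX, Matrix.add_apply,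
    mul_covVec hgb hX (Eventually.of_forall fun _ => confMetric_isSymm) (confConn_koszul hs)
      (hev.mono fun y hy => confMetric_mulVec_raiseConf (h.ne y hy) k), hlie]
  simp only [Matrix.add_apply, Matrix.sub_apply, Matrix.smul_apply, smul_eq_mul]
  ring

theorem k_vecMul_covVec_conf (h : KSChart U p q g H K k m) (hx : x ∈ U) :
    k x ᵥ* covVec (confConn p q) (raiseConf p q k) x = 0 :=
  vecMul_covVec_confConn (h.ne x hx) (h.smooth_k x hx) ((h.eventually_mem hx).mono h.null)

theorem k_vecMul_covVec (h : KSChart U p q g H K k m) (hx : x ∈ U) :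
    k x ᵥ* covVec (christoffel g) (raiseConf p q k) x = 0 := by
  obtain ⟨H', hN⟩ := h.metric_mul_covVec hx
  exact (h.ksPoint hx).k_vecMul_covVec (h.k_vecMul_covVec_conf hx) hN (h.accel_dot_X hx)
    (h.lieDeriv_m_dot_X hx)

theorem covVec_conf_mulVec (h : KSChart U p q g H K k m) (hx : x ∈ U) :
    covVec (confConn p q) (raiseConf p q k) x *ᵥ raiseConf p q k x
      = raiseConf p q (accel p q k) x :=
  covVec_confConn_mulVec (h.ne x hx) (h.smooth_k x hx) (h.null x hx)

theorem covVec_mulVec (h : KSChart U p q g H K k m) (hx : x ∈ U) :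
    covVec (christoffel g) (raiseConf p q k) x *ᵥ raiseConf p q k x
      = raiseConf p q (accel p q k) x + (K x * accelM p q k m x) • raiseConf p q k x := by
  obtain ⟨H', hN⟩ := h.metric_mul_covVec hx
  exact (h.ksPoint hx).covVec_mulVec (h.k_vecMul_covVec_conf hx) hN (h.accel_dot_X hx)
    (h.lieDeriv_m_dot_X hx) (h.accel_dot_raiseM hx) (h.covVec_conf_mulVec hx)
    (h.inv_mulVec_accel hx)

theorem trace_covVec (h : KSChart U p q g H K k m) (hx : x ∈ U) :
    trace (covVec (christoffel g) (raiseConf p q k) x)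
      = trace (covVec (confConn p q) (raiseConf p q k) x) := by
  obtain ⟨H', hN⟩ := h.metric_mul_covVec hx
  exact (h.ksPoint hx).trace_covVec (h.k_vecMul_covVec_conf hx) hN (h.accel_dot_X hx)
    (h.lieDeriv_m_dot_X hx) (h.accel_dot_raiseM hx) (h.covVec_conf_mulVec hx)
    (h.inv_mulVec_accel hx)

theorem trace_covVec_sq (h : KSChart U p q g H K k m) (hx : x ∈ U) :
    trace (covVec (christoffel g) (raiseConf p q k) x
        * covVec (christoffel g) (raiseConf p q k) x)
      = trace (covVec (confConn p q) (raiseConf p q k) x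
        * covVec (confConn p q) (raiseConf p q k) x)
        - K x * ((lieDeriv (raiseM p q K k m) k x + lieDeriv (raiseConf p q k) m x)
          ⬝ᵥ raiseConf p q (accel p q k) x)
        - 2 * H x * (accel p q k x ⬝ᵥ raiseConf p q (accel p q k) x)
        - (∑ c, raiseConf p q k x c * pd c K x) * accelM p q k m x
        + (1 / 2) * K x ^ 2 * (accelM p q k m x ^ 2
          + accel p q k x ⬝ᵥ raiseConf p q (accel p q k) x) := by
  obtain ⟨H', hN⟩ := h.metric_mul_covVec hx
  have hs := h.ne x hx
  have hkB := h.k_vecMul_covVec_conf hx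
  rw [(h.ksPoint hx).trace_covVec_sq hkB hN (h.accel_dot_X hx)
    (h.lieDeriv_m_dot_X hx) (h.accel_dot_raiseM hx) (h.covVec_conf_mulVec hx)
    (h.inv_mulVec_accel hx), add_dotProduct, h.lieDeriv_raiseM_k hx]
  set B := covVec (confConn p q) (raiseConf p q k) x with hB
  set W := raiseConf p q (accel p q k) x with hW
  have hgM : confMetric p q x *ᵥ raiseM p q K k m x = m x + K x • k x := by
    change confMetric p q x *ᵥ (raiseConf p q m x + K x • raiseConf p q k x) = _
    rw [mulVec_add, mulVec_smul, confMetric_mulVec_raiseConf hs, confMetric_mulVec_raiseConf hs]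
  have hlow : ∀ u v : Fin n → ℝ, (confMetric p q x *ᵥ u) ⬝ᵥ B *ᵥ v
      = ∑ d, ∑ a, u d * v a * (confMetric p q x * B) d a := by
    intro u v
    rw [← vecMul_transpose, confMetric_isSymm.eq, ← dotProduct_mulVec, mulVec_mulVec]
    simp only [dotProduct, mulVec, Finset.mul_sum]
    exact Finset.sum_congr rfl fun b _ => Finset.sum_congr rfl fun a _ => by ring
  -- Lowered with the background metric, `B` is antisymmetrised by exchanging `m^♯` and the
  -- acceleration.
  have key : m x ⬝ᵥ B *ᵥ W - accel p q k x ⬝ᵥ B *ᵥ raiseM p q K k m x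
      = -∑ d, ∑ a, raiseM p q K k m x d * W a
        * (pd d (fun y => k y a) x - pd a (fun y => k y d) x) := by
    have e1 : m x ⬝ᵥ B *ᵥ W = (confMetric p q x *ᵥ raiseM p q K k m x) ⬝ᵥ B *ᵥ W := by
      rw [hgM, add_dotProduct, smul_dotProduct, dotProduct_mulVec (k x), hkB, zero_dotProduct,
        smul_zero, add_zero]
    have e2 : accel p q k x ⬝ᵥ B *ᵥ raiseM p q K k m x
        = (confMetric p q x *ᵥ W) ⬝ᵥ B *ᵥ raiseM p q K k m x := by
      rw [hW, confMetric_mulVec_raiseConf hs]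
    have e3 : ∑ d, ∑ a, W d * raiseM p q K k m x a * (confMetric p q x * B) d a
        = ∑ a, ∑ d, W d * raiseM p q K k m x a * (confMetric p q x * B) d a := Finset.sum_comm
    rw [e1, e2, hlow, hlow, e3,
      ← Finset.sum_sub_distrib, ← Finset.sum_neg_distrib]
    refine Finset.sum_congr rfl fun d _ => ?_
    rw [← Finset.sum_sub_distrib, ← Finset.sum_neg_distrib]
    refine Finset.sum_congr rfl fun a _ => ?_
    linear_combination (raiseM p q K k m x d * W a)
      * confMetric_mul_covVec_sub hs (h.smooth_k x hx) d a
  rw [key]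
  ring

/-- The component `R_{ab} k^a k^b` of the Ricci tensor of an extended Kerr–Schild metric. Here
`w_a` is the acceleration of `k` and `μ = w_a m^a`. -/
theorem ricci_k_k (h : KSChart U p q g H K k m) (hx : x ∈ U) :
    ∑ a, ∑ b, ricci g x a b * raiseConf p q k x a * raiseConf p q k x b
      = (∑ c, pd c (fun y => K y * accelM p q k m y * raiseConf p q k y c) x)
        + (∑ c, ∑ e, confConn p q c c e x
          * (K x * accelM p q k m x * raiseConf p q k x e))
        + K x * ((lieDeriv (raiseM p q K k m) k x + lieDeriv (raiseConf p q k) m x)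
          ⬝ᵥ raiseConf p q (accel p q k) x)
        + 2 * H x * (accel p q k x ⬝ᵥ raiseConf p q (accel p q k) x)
        + (∑ c, raiseConf p q k x c * pd c K x) * accelM p q k m x
        - (1 / 2) * K x ^ 2 * (accelM p q k m x ^ 2
          + accel p q k x ⬝ᵥ raiseConf p q (accel p q k) x) := by
  have hs := h.ne x hx
  have hev := h.eventually_mem hx
  have hX := contDiffAt_raiseConf (p := p) (q := q) (h.smooth_k x hx)
  have hW := contDiffAt_raiseConf (p := p) (q := q)
    (contDiffAt_accel (p := p) (q := q) (h.smooth_k x hx))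
  have hM := contDiffAt_raiseConf (p := p) (q := q) (h.smooth_m x hx)
  have hμ : ContDiffAt ℝ ∞ (accelM p q k m) x :=
    (ContDiffAt.sum fun a _ => (contDiffAt_accel (p := p) (q := q) (h.smooth_k x hx) a).mul (hM a) :
      ContDiffAt ℝ ∞ (fun y => ∑ a, accel p q k y a * raiseConf p q m y a) x)
  have hKμ : ∀ c, DifferentiableAt ℝ
      (fun y => K y * accelM p q k m y * raiseConf p q k y c) x := fun c =>
    (((h.smooth_K x hx).mul hμ).mul (hX c)).diffAt
  have hbar := connRicci_apply_apply (confConn p q) (raiseConf p q k) x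
    (fun a b c => (contDiffAt_confConn hs a b c).diffAt)
    (fun a b c => by rw [confConn_symm]) hX
  have hg := connRicci_apply_apply (christoffel g) (raiseConf p q k) x
    (fun a b c => (h.contDiffAt_christoffel hx a b c).diffAt)
    (fun a b c => hev.mono fun y hy => christoffel_symm (h.eventually_isSymm hy) a b c) hX
  -- The background is an Einstein space, and `k` is null.
  have hbar0 : ∑ a, ∑ b, connRicci (confConn p q) a b x * raiseConf p q k x a
      * raiseConf p q k x b = 0 := by
    have h0 := h.null x hx
    simp only [connRicci_confConn hs, mul_ite, mul_zero, ite_mul, zero_mul, Finset.sum_ite_eq,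
      Finset.mem_univ, if_true]
    have : ∀ a, (1 - n) * (affine p q x)⁻¹ ^ 2 * (∑ c, minkSign c * p c ^ 2) * minkSign a
        * raiseConf p q k x a * raiseConf p q k x a
        = ((1 - n) * (affine p q x)⁻¹ ^ 2 * (∑ c, minkSign c * p c ^ 2) * affine p q x ^ 4)
          * (minkSign a * (k x a * k x a)) := by
      intro a
      unfold raiseConf
      linear_combination ((1 - n) * (affine p q x)⁻¹ ^ 2 * (∑ c, minkSign c * p c ^ 2)
        * affine p q x ^ 4 * minkSign a * (k x a * k x a)) * minkSign_mul_self a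
    simp only [this, ← Finset.mul_sum, h0, mul_zero]
  have t1 : ∀ c, pd c (fun y => (covVec (christoffel g) (raiseConf p q k) y
        *ᵥ raiseConf p q k y) c) x
      = pd c (fun y => (covVec (confConn p q) (raiseConf p q k) y *ᵥ raiseConf p q k y) c) x
        + pd c (fun y => K y * accelM p q k m y * raiseConf p q k y c) x := by
    intro c
    have e1 : (fun y => (covVec (christoffel g) (raiseConf p q k) y *ᵥ raiseConf p q k y) c)
        =ᶠ[𝓝 x] fun y => raiseConf p q (accel p q k) y c
          + K y * accelM p q k m y * raiseConf p q k y c :=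
      hev.mono fun y hy => congrFun (h.covVec_mulVec hy) c
    have e2 : (fun y => (covVec (confConn p q) (raiseConf p q k) y *ᵥ raiseConf p q k y) c)
        =ᶠ[𝓝 x] fun y => raiseConf p q (accel p q k) y c :=
      hev.mono fun y hy => congrFun (h.covVec_conf_mulVec hy) c
    rw [pd_congr c e1, pd_congr c e2, pd_add c (hW c).diffAt (hKμ c)]
  have t2 : ∀ v : Fin n → ℝ, ∑ c, ∑ e, christoffel g c c e x * v e
      = ∑ c, ∑ e, confConn p q c c e x * v e := by
    intro v
    rw [Finset.sum_comm, Finset.sum_comm (f := fun c e => confConn p q c c e x * v e)]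
    exact Finset.sum_congr rfl fun e _ => by
      rw [← Finset.sum_mul, ← Finset.sum_mul, h.sum_christoffel_eq hx]
  have t3 : ∀ a, pd a (fun y => trace (covVec (christoffel g) (raiseConf p q k) y)) x
      = pd a (fun y => trace (covVec (confConn p q) (raiseConf p q k) y)) x := fun a =>
    pd_congr a (hev.mono fun y hy => h.trace_covVec hy)
  have hric : ∑ a, ∑ b, ricci g x a b * raiseConf p q k x a * raiseConf p q k x b
      = ∑ a, ∑ b, connRicci (christoffel g) a b x * raiseConf p q k x a
        * raiseConf p q k x b := rfl
  have hsplit : ∑ c, ∑ e, confConn p q c c e x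
        * (covVec (christoffel g) (raiseConf p q k) x *ᵥ raiseConf p q k x) e
      = (∑ c, ∑ e, confConn p q c c e x
        * (covVec (confConn p q) (raiseConf p q k) x *ᵥ raiseConf p q k x) e)
        + ∑ c, ∑ e, confConn p q c c e x * (K x * accelM p q k m x * raiseConf p q k x e) := by
    rw [h.covVec_mulVec hx, h.covVec_conf_mulVec hx]
    simp only [Pi.add_apply, Pi.smul_apply, smul_eq_mul, mul_add, Finset.sum_add_distrib]
  rw [hbar0] at hbar
  rw [hric, hg]
  simp only [t1, t2, t3, hsplit, Finset.sum_add_distrib]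
  rw [h.trace_covVec_sq hx]
  linear_combination -hbar

end KSChart

namespace KSChart

variable [NeZero n] {U : Set (Pt n)} {p : Fin n → ℝ} {q : ℝ} {g T : Tensor2 n}
  {H K : Scalar n} {k m : Field n} {x : Pt n}

/-! ### The energy–momentum component, geodeticity and the Lie derivative conditions -/

/-- The trace and cosmological terms of the Einstein equations drop out because `k` is null. -/
theorem einstein_T00 (h : KSChart U p q g H K k m) (hx : x ∈ U) {Λ : ℝ}
    (hE : EinsteinEquations U Λ g T) : 8 * Real.pi * T00 g T k x
      = ∑ a, ∑ b, ricci g x a b * raiseConf p q k x a * raiseConf p q k x b := by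
  have hgX : g x *ᵥ raiseConf p q k x = k x := by
    rw [← h.ksInv_mulVec_k hx, mulVec_mulVec, h.mul_ksInv hx, one_mulVec]
  have h0 : ∑ a, ∑ b, g x a b * raiseConf p q k x a * raiseConf p q k x b = 0 := by
    rw [← h.kX hx]
    conv_rhs => rw [← hgX]
    simp only [dotProduct, mulVec, Finset.sum_mul]
    exact Finset.sum_congr rfl fun a _ => Finset.sum_congr rfl fun b _ => by
      rw [← (h.isSymm hx).apply a b]; ring
  rw [T00, h.raise_k hx, Finset.mul_sum, ← sub_eq_zero, ← Finset.sum_sub_distrib,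
    ← mul_zero (Λ - (1 / 2) * ricciScalar g x), ← h0, Finset.mul_sum]
  refine Finset.sum_congr rfl fun a _ => ?_
  rw [Finset.mul_sum, Finset.mul_sum, ← Finset.sum_sub_distrib]
  refine Finset.sum_congr rfl fun b _ => ?_
  linear_combination -(raiseConf p q k x a * raiseConf p q k x b) * hE x hx a b

theorem isGeodetic_iff (h : KSChart U p q g H K k m) :
    IsGeodetic U g k ↔ ∃ f : Scalar n, ∀ x ∈ U, ∀ a, accel p q k x a = f x * k x a := by
  have : ∀ x ∈ U, ∀ a, ∑ b, covDeriv g k a b x * raise g k x b = accel p q k x a := by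
    intro x hx a
    rw [h.raise_k hx, sum_covDeriv_mul (h.k_vecMul_covVec hx) (h.sum_k_mul_pd hx) a]
    rfl
  constructor
  · rintro ⟨f, hf⟩
    exact ⟨f, fun x hx a => by rw [← this x hx a]; exact hf x hx a⟩
  · rintro ⟨f, hf⟩
    exact ⟨f, fun x hx a => by rw [← hf x hx a]; exact this x hx a⟩

theorem lieDeriv_raiseM_k_dot_X (h : KSChart U p q g H K k m) (hx : x ∈ U) :
    lieDeriv (raiseM p q K k m) k x ⬝ᵥ raiseConf p q k x = -accelM p q k m x := by
  rw [h.lieDeriv_raiseM_k hx, ← h.accel_dot_raiseM hx]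
  have h1 : ∀ d, ∑ a, raiseM p q K k m x d * raiseConf p q k x a
      * (pd d (fun y => k y a) x - pd a (fun y => k y d) x)
      = raiseM p q K k m x d * (∑ a, pd d (fun y => k y a) x * raiseConf p q k x a)
        - accel p q k x d * raiseM p q K k m x d := by
    intro d
    simp only [accel, Finset.mul_sum, Finset.sum_mul, ← Finset.sum_sub_distrib]
    exact Finset.sum_congr rfl fun a _ => by ring
  simp only [h1, h.pd_k_dot_X hx, mul_zero, zero_sub, Finset.sum_neg_distrib]
  rfl

/-- If the acceleration of `k` has no component along `m`, the derivative terms in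
`R_{ab} k^a k^b` disappear. -/
theorem ricci_k_k_of_accelM_eq_zero (h : KSChart U p q g H K k m) (hx : x ∈ U)
    (hμ : ∀ y ∈ U, accelM p q k m y = 0) :
    ∑ a, ∑ b, ricci g x a b * raiseConf p q k x a * raiseConf p q k x b
      = K x * ((lieDeriv (raiseM p q K k m) k x + lieDeriv (raiseConf p q k) m x)
          ⬝ᵥ raiseConf p q (accel p q k) x)
        + (1 / 2) * (4 * H x - K x ^ 2)
          * (accel p q k x ⬝ᵥ raiseConf p q (accel p q k) x) := by
  have h1 : ∀ c, pd c (fun y => K y * accelM p q k m y * raiseConf p q k y c) x = 0 := by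
    intro c
    rw [← pd_const c 0 x]
    exact pd_congr c ((h.eventually_mem hx).mono fun y hy => by simp [hμ y hy])
  rw [h.ricci_k_k hx]
  simp only [h1, hμ x hx, mul_zero, zero_mul, Finset.sum_const_zero]
  ring

theorem T00_eq_zero_of_isGeodetic (h : KSChart U p q g H K k m) {Λ : ℝ}
    (hE : EinsteinEquations U Λ g T) (hgeo : IsGeodetic U g k) (hx : x ∈ U) :
    T00 g T k x = 0 := by
  obtain ⟨f, hf⟩ := h.isGeodetic_iff.1 hgeo
  have hw : ∀ y ∈ U, accel p q k y = f y • k y := fun y hy => funext (hf y hy)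
  have hμ : ∀ y ∈ U, accelM p q k m y = 0 := fun y hy => by
    rw [accelM, hw y hy, smul_dotProduct, h.kM hy, smul_zero]
  have hW : raiseConf p q (accel p q k) x = f x • raiseConf p q k x := by
    ext a
    simp only [raiseConf, hw x hx, Pi.smul_apply, smul_eq_mul]
    ring
  have h8 := h.einstein_T00 hx hE
  rw [h.ricci_k_k_of_accelM_eq_zero hx hμ, hW, hw x hx] at h8
  simp only [dotProduct_smul, smul_dotProduct, add_dotProduct, h.lieDeriv_raiseM_k_dot_X hx,
    h.lieDeriv_m_dot_X hx, hμ x hx, h.kX hx, smul_zero, mul_zero, neg_zero, add_zero] at h8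
  exact (mul_eq_zero.1 h8).resolve_left (by positivity)

end KSChart

/-- In Minkowski space a null vector that is orthogonal to a nonzero null vector is
proportional to it. -/
theorem exists_eq_mul_of_null [NeZero n] {u v : Fin n → ℝ} (hu : u ≠ 0)
    (huu : ∑ a, minkSign a * (u a * u a) = 0) (huv : ∑ a, minkSign a * (u a * v a) = 0)
    (hvv : ∑ a, minkSign a * (v a * v a) = 0) : ∃ f : ℝ, ∀ a, v a = f * u a := by
  have key : ∀ z : Fin n → ℝ, z 0 = 0 → ∑ a, minkSign a * (z a * z a) = 0 → z = 0 := by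
    intro z hz0 hz
    have h1 : ∀ a, minkSign a * (z a * z a) = z a * z a := by
      intro a
      unfold minkSign
      split_ifs with h
      · rw [h, hz0]; ring
      · ring
    simp only [h1] at hz
    funext a
    exact mul_self_eq_zero.1
      ((Finset.sum_eq_zero_iff_of_nonneg fun a _ => mul_self_nonneg (z a)).1 hz a
        (Finset.mem_univ a))
  have hu0 : u 0 ≠ 0 := fun h0 => hu (key u h0 huu)
  refine ⟨v 0 / u 0, fun a => ?_⟩
  have h2 := key (fun a => v a - v 0 / u 0 * u a) (by field_simp; ring) (by
    have : ∀ a, minkSign a * ((v a - v 0 / u 0 * u a) * (v a - v 0 / u 0 * u a))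
        = minkSign a * (v a * v a) - 2 * (v 0 / u 0) * (minkSign a * (u a * v a))
          + (v 0 / u 0) ^ 2 * (minkSign a * (u a * u a)) := fun a => by ring
    simp only [this, Finset.sum_add_distrib, Finset.sum_sub_distrib, ← Finset.mul_sum, huu, huv,
      hvv]
    ring)
  exact sub_eq_zero.1 (congrFun h2 a)

theorem lieDeriv_congr {X Y α : Field n} {x : Pt n} (h : X =ᶠ[𝓝 x] Y) :
    lieDeriv X α x = lieDeriv Y α x := by
  ext a
  simp only [lieDeriv, h.eq_of_nhds]
  refine Finset.sum_congr rfl fun b _ => ?_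
  rw [pd_congr a (h.mono fun y hy => congrFun hy b : (fun y => X y b) =ᶠ[𝓝 x] fun y => Y y b)]

namespace KSChart

variable [NeZero n] {U : Set (Pt n)} {p : Fin n → ℝ} {q : ℝ} {g T : Tensor2 n}
  {H K : Scalar n} {k m : Field n} {x : Pt n}

theorem isGeodetic_of_T00_eq_zero (h : KSChart U p q g H K k m) {Λ : ℝ}
    (hE : EinsteinEquations U Λ g T) (hk0 : ∀ x ∈ U, k x ≠ 0)
    (hkm : ProportionalOn U (lieDeriv (raise g k) m) m)
    (hmk : ∀ x ∈ U, lieDeriv (raise g m) k x = 0)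
    (hdense : U ⊆ closure {x ∈ U | 4 * H x ≠ K x ^ 2})
    (hT : ∀ x ∈ U, T00 g T k x = 0) : IsGeodetic U g k := by
  obtain ⟨φ, hφ⟩ := hkm
  have hLk : ∀ x ∈ U, lieDeriv (raiseM p q K k m) k x = 0 := fun x hx => by
    rw [← hmk x hx]
    exact lieDeriv_congr ((h.eventually_mem hx).mono fun y hy => (h.raise_m hy).symm)
  have hLm : ∀ x ∈ U, lieDeriv (raiseConf p q k) m x = φ x • m x := fun x hx => by
    rw [← lieDeriv_congr ((h.eventually_mem hx).mono fun y hy => h.raise_k hy)]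
    exact funext (hφ x hx)
  have hμ : ∀ x ∈ U, accelM p q k m x = 0 := fun x hx => by
    have := h.lieDeriv_raiseM_k_dot_X hx
    rw [hLk x hx, zero_dotProduct] at this
    linarith
  have hQ : ∀ x ∈ U, (4 * H x - K x ^ 2)
      * (accel p q k x ⬝ᵥ raiseConf p q (accel p q k) x) = 0 := fun x hx => by
    have h8 := h.einstein_T00 hx hE
    have h9 : m x ⬝ᵥ raiseConf p q (accel p q k) x = 0 := by
      rw [dotProduct_raiseConf_comm]; exact hμ x hx
    rw [hT x hx, h.ricci_k_k_of_accelM_eq_zero hx hμ, hLk x hx, hLm x hx, zero_add,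
      smul_dotProduct, h9] at h8
    simp only [smul_zero, mul_zero, zero_add] at h8
    linarith
  -- The norm of the acceleration is continuous and vanishes on a dense subset.
  have hww : ∀ x ∈ U, accel p q k x ⬝ᵥ raiseConf p q (accel p q k) x = 0 := by
    intro x hx
    by_contra hne
    have hw := contDiffAt_accel (p := p) (q := q) (h.smooth_k x hx)
    have hcont : ContinuousAt (fun y => accel p q k y ⬝ᵥ raiseConf p q (accel p q k) y) x :=
      (ContDiffAt.sum fun a _ => (hw a).mul (contDiffAt_raiseConf (p := p) (q := q) hw a) :
        ContDiffAt ℝ ∞ (fun y => ∑ a, accel p q k y a * raiseConf p q (accel p q k) y a)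
          x).continuousAt
    obtain ⟨y, hy, hyU, hyne⟩ := mem_closure_iff_nhds.1 (hdense hx) _ (hcont.eventually_ne hne)
    exact (mul_ne_zero (sub_ne_zero.2 hyne) hy) (hQ y hyU)
  have hex : ∀ x ∈ U, ∃ f : ℝ, ∀ a, accel p q k x a = f * k x a := by
    intro x hx
    have hs2 : affine p q x ^ 2 ≠ 0 := pow_ne_zero 2 (h.ne x hx)
    refine exists_eq_mul_of_null (hk0 x hx) (h.null x hx) ?_ ?_
    · have := h.accel_dot_X hx
      rw [dotProduct_raiseConf_comm, dotProduct_raiseConf] at this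
      exact (mul_eq_zero.1 this).resolve_left hs2
    · have := hww x hx
      rw [dotProduct_raiseConf] at this
      exact (mul_eq_zero.1 this).resolve_left hs2
  choose! f hf using hex
  exact h.isGeodetic_iff.2 ⟨f, hf⟩

end KSChart

/-! ### Minkowski and (anti-)de Sitter backgrounds -/

/-- In each of the three cases the conformal factor is `s⁻²` with `s` affine. -/
theorem IsBackgroundFactor.exists_affine [NeZero n] (hn : 3 ≤ n) {U : Set (Pt n)} {Ω : Scalar n}
    (h : IsBackgroundFactor U Ω) :
    ∃ p q, ∀ x ∈ U, affine p q x ≠ 0 ∧ Ω x = (affine p q x ^ 2)⁻¹ := by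
  have hn3 : (3 : ℝ) ≤ n := by exact_mod_cast hn
  have hpos : 0 < ((n : ℝ) - 2) * ((n : ℝ) - 1) := mul_pos (by linarith) (by linarith)
  have key : ∀ (c : ℝ) (i : Fin n), 0 < c → (∀ x ∈ U, x i ≠ 0 ∧ Ω x = c / x i ^ 2) →
      ∃ p q, ∀ x ∈ U, affine p q x ≠ 0 ∧ Ω x = (affine p q x ^ 2)⁻¹ := by
    intro c i hc hΩ
    have hsc : Real.sqrt c ≠ 0 := (Real.sqrt_pos.2 hc).ne'
    refine ⟨Pi.single i (Real.sqrt c)⁻¹, 0, fun x hx => ?_⟩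
    have ha : affine (Pi.single i (Real.sqrt c)⁻¹) 0 x = (Real.sqrt c)⁻¹ * x i := by
      simp [affine, Pi.single_apply]
    obtain ⟨h1, h2⟩ := hΩ x hx
    refine ⟨by rw [ha]; exact mul_ne_zero (inv_ne_zero hsc) h1, ?_⟩
    rw [ha, h2, mul_pow, inv_pow, Real.sq_sqrt hc.le, mul_inv, inv_inv, div_eq_mul_inv]
  rcases h with h | ⟨Λ, hΛ, h⟩ | ⟨Λ, hΛ, h⟩
  · exact ⟨0, 1, fun x hx => by simp [affine, h x hx]⟩
  · refine key (((n : ℝ) - 2) * ((n : ℝ) - 1) / (2 * Λ)) 0 (by positivity) fun x hx => ?_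
    obtain ⟨h1, h2⟩ := h x hx
    exact ⟨h1, by rw [h2, div_div]⟩
  · refine key (((n : ℝ) - 2) * ((n : ℝ) - 1) / (2 * -Λ)) 1
      (div_pos hpos (by linarith)) fun x hx => ?_
    obtain ⟨h1, h2⟩ := h x hx
    refine ⟨h1, ?_⟩
    rw [h2, div_div, ← div_neg]
    congr 1
    ring

theorem eq_raiseConf_of_mulVec_eq [NeZero n] {p : Fin n → ℝ} {q : ℝ} {x : Pt n}
    (hs : affine p q x ≠ 0) {v : Fin n → ℝ} {α : Field n} (h : confMetric p q x *ᵥ v = α x) :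
    v = raiseConf p q α x := by
  ext a
  have h1 := congrFun h a
  simp only [confMetric, smul_mulVec, minkowski, mulVec_diagonal, Pi.smul_apply, smul_eq_mul]
    at h1
  change (affine p q x ^ 2)⁻¹ * (minkSign a * v a) = _ at h1
  rw [raiseConf, ← h1]
  field_simp
  rw [sq, minkSign_mul_self, mul_one]

/-- The conditions on `k` and `m` with respect to the full metric translate to the background.
The unit norm of `m` excludes a degenerate `g`, whose matrix inverse is zero by convention. -/
theorem IsExtendedKerrSchild.exists_chart [NeZero n] (hn : 3 ≤ n) {U : Set (Pt n)}
    {gbar g : Tensor2 n} {H K : Scalar n} {k m : Field n} (hU : IsOpen U)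
    (h : IsExtendedKerrSchild U gbar g H K k m) : ∃ p q, KSChart U p q g H K k m := by
  obtain ⟨Ω, hΩ, hgbar⟩ := h.background
  obtain ⟨p, q, hpq⟩ := hΩ.exists_affine hn
  have hmet : ∀ x ∈ U, g x = confMetric p q x - (2 * H x) • vecMulVec (k x) (k x)
      - K x • (vecMulVec (k x) (m x) + vecMulVec (m x) (k x)) := by
    intro x hx
    ext a b
    rw [h.metric_eq x hx, hgbar x hx, (hpq x hx).2]
    simp only [confMetric, Matrix.sub_apply, Matrix.add_apply, Matrix.smul_apply, vecMulVec_apply,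
      smul_eq_mul]
    ring
  have key : ∀ x ∈ U, k x ⬝ᵥ raiseConf p q k x = 0 ∧ k x ⬝ᵥ raiseConf p q m x = 0
      ∧ m x ⬝ᵥ raiseConf p q m x = 1 := by
    intro x hx
    have hs := (hpq x hx).1
    have hkk : k x ⬝ᵥ (g x)⁻¹ *ᵥ k x = 0 := by rw [dotProduct_comm]; exact h.k_null x hx
    have hmk : m x ⬝ᵥ (g x)⁻¹ *ᵥ k x = 0 := by rw [dotProduct_comm]; exact h.k_orthogonal_m x hx
    have hmm : m x ⬝ᵥ (g x)⁻¹ *ᵥ m x = 1 := by rw [dotProduct_comm]; exact h.m_unit x hx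
    have hdet : IsUnit (g x).det := by
      by_contra hdet
      rw [nonsing_inv_apply_not_isUnit _ hdet, zero_mulVec, dotProduct_zero] at hmm
      exact zero_ne_one hmm
    have hgg : g x * (g x)⁻¹ = 1 := mul_nonsing_inv _ hdet
    have hsymm : (g x).IsSymm := by
      rw [hmet x hx]
      ext a b
      simp only [transpose_apply, Matrix.sub_apply, Matrix.add_apply, Matrix.smul_apply,
        vecMulVec_apply, smul_eq_mul, confMetric_isSymm.apply b a]
      ring
    have hkm : k x ⬝ᵥ (g x)⁻¹ *ᵥ m x = 0 := by
      rw [dotProduct_mulVec, ← mulVec_transpose, transpose_nonsing_inv, hsymm.eq,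
        dotProduct_comm, hmk]
    have hg : ∀ v : Fin n → ℝ, confMetric p q x *ᵥ ((g x)⁻¹ *ᵥ v) = v
        + (2 * H x * (k x ⬝ᵥ (g x)⁻¹ *ᵥ v)) • k x + K x • ((m x ⬝ᵥ (g x)⁻¹ *ᵥ v) • k x
          + (k x ⬝ᵥ (g x)⁻¹ *ᵥ v) • m x) := by
      intro v
      have h1 : confMetric p q x = g x + (2 * H x) • vecMulVec (k x) (k x)
          + K x • (vecMulVec (k x) (m x) + vecMulVec (m x) (k x)) := by rw [hmet x hx]; abel
      have h2 : g x *ᵥ ((g x)⁻¹ *ᵥ v) = v := by rw [mulVec_mulVec, hgg, one_mulVec]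
      rw [h1]
      simp only [add_mulVec, smul_mulVec, vecMulVec_mulVec, h2, op_smul_eq_smul, smul_smul]
    have hX : (g x)⁻¹ *ᵥ k x = raiseConf p q k x := by
      refine eq_raiseConf_of_mulVec_eq hs ?_
      rw [hg, hkk, hmk]
      simp
    have hM : (g x)⁻¹ *ᵥ m x = raiseConf p q m x + K x • raiseConf p q k x := by
      have h1 : (g x)⁻¹ *ᵥ m x = raiseConf p q (fun y => m y + K y • k y) x := by
        refine eq_raiseConf_of_mulVec_eq hs ?_
        rw [hg, hkm, hmm]
        simp
      rw [h1]
      ext a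
      simp only [raiseConf, Pi.add_apply, Pi.smul_apply, smul_eq_mul]
      ring
    rw [hX] at hkk hmk
    rw [hM, dotProduct_add, dotProduct_smul] at hkm hmm
    rw [hkk] at hkm
    rw [hmk] at hmm
    exact ⟨hkk, by simpa using hkm, by simpa using hmm⟩
  refine ⟨p, q, hU, fun x hx => (hpq x hx).1, fun x hx => h.smooth_H.contDiffAt (hU.mem_nhds hx),
    fun x hx => h.smooth_K.contDiffAt (hU.mem_nhds hx), fun x hx a =>
    contDiffAt_pi.1 (h.smooth_k.contDiffAt (hU.mem_nhds hx)) a, fun x hx a =>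
    contDiffAt_pi.1 (h.smooth_m.contDiffAt (hU.mem_nhds hx)) a, hmet, fun x hx => ?_,
    fun x hx => ?_, fun x hx => (key x hx).2.2⟩
  · have := (key x hx).1
    rw [dotProduct_raiseConf] at this
    exact (mul_eq_zero.1 this).resolve_left (pow_ne_zero 2 (hpq x hx).1)
  · have := (key x hx).2.1
    rw [dotProduct_raiseConf] at this
    exact (mul_eq_zero.1 this).resolve_left (pow_ne_zero 2 (hpq x hx).1)

/-! ### A non-geodetic example with vanishing `T₀₀` -/

section Example

variable [NeZero n]

/-- The null one-form `-dt + cos t dx₁ + sin t dx₂`. -/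
noncomputable def rotK : Field n := fun y a =>
  if (a : ℕ) = 0 then -1 else if (a : ℕ) = 1 then Real.cos (y 0)
  else if (a : ℕ) = 2 then Real.sin (y 0) else 0

/-- The unit one-form `-sin t dx₁ + cos t dx₂`, orthogonal to `rotK`. -/
noncomputable def rotM : Field n := fun y a =>
  if (a : ℕ) = 1 then -Real.sin (y 0) else if (a : ℕ) = 2 then Real.cos (y 0) else 0

/-- The metric `η_{ab} - (k_a m_b + m_a k_b)` with `k` and `m` the one-forms `rotK` and `rotM`, that
is, `H = 0` and `K = 1`. -/
noncomputable def rotMetric : Tensor2 n := fun x => confMetric 0 1 x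
  - (2 * 0 : ℝ) • vecMulVec (rotK x) (rotK x)
  - (1 : ℝ) • (vecMulVec (rotK x) (rotM x) + vecMulVec (rotM x) (rotK x))

theorem rotK_of_three_le {a : Fin n} (ha : 3 ≤ (a : ℕ)) (x : Pt n) : rotK x a = 0 := by
  rw [rotK, if_neg (by omega), if_neg (by omega), if_neg (by omega)]

theorem rotM_of_three_le {a : Fin n} (ha : 3 ≤ (a : ℕ)) (x : Pt n) : rotM x a = 0 := by
  rw [rotM, if_neg (by omega), if_neg (by omega)]

theorem sum_eq_three (hn : 3 ≤ n) (f : Fin n → ℝ) (hf : ∀ a : Fin n, 3 ≤ (a : ℕ) → f a = 0) :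
    ∑ a, f a = f 0 + f ⟨1, by omega⟩ + f ⟨2, by omega⟩ := by
  obtain ⟨j, rfl⟩ : ∃ j, n = j + 3 := ⟨n - 3, by omega⟩
  rw [Fin.sum_univ_succ, Fin.sum_univ_succ, Fin.sum_univ_succ,
    Finset.sum_eq_zero fun i _ => hf _ (by simp), add_zero, ← add_assoc]
  rfl

theorem pd_rotK (a b : Fin n) (x : Pt n) :
    pd b (fun y => rotK y a) x = if b = 0 then rotM x a else 0 := by
  have h0 : HasFDerivAt (fun y : Pt n => y 0) (ContinuousLinearMap.proj (R := ℝ) 0) x :=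
    hasFDerivAt_apply (𝕜 := ℝ) 0 x
  unfold rotK rotM
  by_cases h1 : (a : ℕ) = 0
  · have : pd b (fun _ => -1) x = 0 := pd_const b (-1) x
    simpa [h1] using this
  by_cases h2 : (a : ℕ) = 1
  · simp only [h2, if_true, one_ne_zero, if_false, pd, h0.cos.fderiv]
    simp [Pi.single_apply, eq_comm]
  by_cases h3 : (a : ℕ) = 2
  · simp only [h3, if_true, OfNat.ofNat_ne_zero, OfNat.ofNat_ne_one, if_false, pd, h0.sin.fderiv]
    simp [Pi.single_apply, eq_comm]
  · simpa [h1, h2, h3] using pd_const b 0 x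

theorem pd_rotM (a b : Fin n) (x : Pt n) : pd b (fun y => rotM y a) x
    = if b = 0 then -(if (a : ℕ) = 0 then 0 else rotK x a) else 0 := by
  have h0 : HasFDerivAt (fun y : Pt n => y 0) (ContinuousLinearMap.proj (R := ℝ) 0) x :=
    hasFDerivAt_apply (𝕜 := ℝ) 0 x
  unfold rotK rotM
  by_cases h1 : (a : ℕ) = 0
  · simpa [h1] using pd_const b 0 x
  by_cases h2 : (a : ℕ) = 1
  · simp only [h2, if_true, one_ne_zero, if_false, pd, h0.sin.fun_neg.fderiv]
    by_cases hb : b = 0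
    · subst hb; simp
    · simp [hb, Ne.symm hb]
  by_cases h3 : (a : ℕ) = 2
  · simp only [h3, if_true, OfNat.ofNat_ne_zero, OfNat.ofNat_ne_one, if_false, pd, h0.cos.fderiv]
    simp [Pi.single_apply, eq_comm]
  · simpa [h1, h2, h3] using pd_const b 0 x

theorem contDiff_rotK (a : Fin n) : ContDiff ℝ ∞ (fun y : Pt n => rotK y a) := by
  unfold rotK; split_ifs <;> fun_prop

theorem contDiff_rotM (a : Fin n) : ContDiff ℝ ∞ (fun y : Pt n => rotM y a) := by
  unfold rotM; split_ifs <;> fun_prop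

omit [NeZero n] in
theorem affine_zero_one (x : Pt n) : affine 0 1 x = 1 := by simp [affine]

theorem raiseConf_zero_one (α : Field n) (x : Pt n) (a : Fin n) :
    raiseConf 0 1 α x a = minkSign a * α x a := by
  rw [raiseConf, affine_zero_one]; ring

theorem rotM_zero (x : Pt n) : rotM x 0 = 0 := by simp [rotM]

theorem raiseConf_rotM (x : Pt n) : raiseConf 0 1 rotM x = rotM x := by
  ext a
  rw [raiseConf_zero_one, minkSign]
  split_ifs with h
  · rw [h, rotM_zero]; ring
  · ring

theorem raiseConf_rotK_zero (x : Pt n) : raiseConf 0 1 rotK x 0 = 1 := by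
  rw [raiseConf_zero_one]; simp [minkSign, rotK]

theorem accel_rotK : accel 0 1 (rotK : Field n) = rotM := by
  funext x a
  simp [accel, pd_rotK, raiseConf_rotK_zero]

theorem rotM_dot_rotM (hn : 3 ≤ n) (x : Pt n) : rotM x ⬝ᵥ rotM x = 1 := by
  rw [dotProduct, sum_eq_three hn _ fun a ha => by
    rw [rotM_of_three_le ha, mul_zero]]
  simp [rotM]
  nlinarith [Real.sin_sq_add_cos_sq (x 0)]

theorem minkSign_of_ne_zero {a : Fin n} (ha : (a : ℕ) ≠ 0) : minkSign a = 1 :=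
  if_neg fun h => ha (by simp [h])

theorem ksChart_rot (hn : 3 ≤ n) : KSChart Set.univ 0 1 rotMetric (fun _ => 0)
    (fun _ => 1) (rotK : Field n) rotM where
  isOpen := isOpen_univ
  ne x _ := by rw [affine_zero_one]; exact one_ne_zero
  smooth_H _ _ := contDiffAt_const
  smooth_K _ _ := contDiffAt_const
  smooth_k _ _ a := (contDiff_rotK a).contDiffAt
  smooth_m _ _ a := (contDiff_rotM a).contDiffAt
  metric_eq _ _ := rfl
  null x _ := by
    rw [sum_eq_three hn _ fun a ha => by
      rw [rotK_of_three_le ha]; ring]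
    rw [minkSign_of_ne_zero (a := ⟨1, by omega⟩) (by simp),
      minkSign_of_ne_zero (a := ⟨2, by omega⟩) (by simp)]
    simp [rotK, minkSign]
    nlinarith [Real.sin_sq_add_cos_sq (x 0)]
  orth x _ := by
    rw [sum_eq_three hn _ fun a ha => by
      rw [rotK_of_three_le ha]; ring]
    rw [minkSign_of_ne_zero (a := ⟨1, by omega⟩) (by simp),
      minkSign_of_ne_zero (a := ⟨2, by omega⟩) (by simp)]
    simp [rotK, rotM]
    ring
  unit x _ := by rw [raiseConf_rotM, rotM_dot_rotM hn]

/-- Here `μ = |w|² = 1`, `(ℒ_m k)(w) = 1` and `(ℒ_k m)(w) = 0`, so that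
`K (ℒ_m k + ℒ_k m)(w) = 1` cancels `K² (μ² + |w|²) / 2 = 1`, and all other terms vanish. -/
theorem ricci_rot (hn : 3 ≤ n) (x : Pt n) :
    ∑ a, ∑ b, ricci rotMetric x a b
      * raiseConf 0 1 rotK x a * raiseConf 0 1 (rotK : Field n) x b = 0 := by
  have h := ksChart_rot hn
  have hμ : accelM 0 1 (rotK : Field n) rotM = fun _ => 1 := by
    funext y; rw [accelM, accel_rotK, raiseConf_rotM, rotM_dot_rotM hn]
  have h1 : ∀ c, pd c (fun y => (1 : ℝ) * 1 * raiseConf 0 1 (rotK : Field n) y c) x = 0 := by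
    intro c
    have hd := ((contDiff_rotK c).contDiffAt (x := x)).diffAt
    simp only [one_mul, raiseConf_zero_one]
    rw [pd_const_mul c _ hd, pd_rotK]
    split_ifs with hc
    · rw [hc, rotM_zero, mul_zero]
    · rw [mul_zero]
  have h2 : ∀ a b c : Fin n, confConn 0 1 a b c x = 0 := fun a b c => by simp [confConn]
  have h3 : lieDeriv (raiseM 0 1 (fun _ => 1) (rotK : Field n) rotM) rotK x ⬝ᵥ rotM x = 1 := by
    have hM0 : raiseM 0 1 (fun _ => 1) (rotK : Field n) rotM x 0 = 1 := by
      rw [raiseM, raiseConf_rotK_zero, raiseConf_rotM, rotM_zero]; norm_num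
    rw [h.lieDeriv_raiseM_k (Set.mem_univ x)]
    simp only [pd_rotK, mul_sub, mul_ite, mul_zero, Finset.sum_sub_distrib,
      Finset.sum_ite_eq', Finset.mem_univ, if_true, rotM_zero, zero_mul,
      sub_zero]
    rw [Finset.sum_comm]
    simp only [Finset.sum_ite_eq', Finset.mem_univ, if_true, hM0, one_mul]
    exact rotM_dot_rotM hn x
  have h4 : lieDeriv (raiseConf 0 1 (rotK : Field n)) rotM x ⬝ᵥ rotM x = 0 := by
    have hpX : ∀ a b : Fin n, pd a (fun y => raiseConf 0 1 (rotK : Field n) y b) x * rotM x a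
        = 0 := by
      intro a b
      have hd := ((contDiff_rotK b).contDiffAt (x := x)).diffAt
      simp only [raiseConf_zero_one]
      rw [pd_const_mul a _ hd, pd_rotK]
      split_ifs with ha
      · rw [ha, rotM_zero, mul_zero]
      · rw [mul_zero, zero_mul]
    have : ∀ a, lieDeriv (raiseConf 0 1 (rotK : Field n)) rotM x a * rotM x a
        = -(if (a : ℕ) = 0 then 0 else rotK x a) * rotM x a := by
      intro a
      have hz : ∀ b, pd a (fun y => raiseConf 0 1 (rotK : Field n) y b) x * rotM x b * rotM x a
          = 0 := fun b => by rw [mul_right_comm, hpX, zero_mul]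
      rw [lieDeriv, Finset.sum_mul]
      simp only [add_mul, hz, add_zero, pd_rotM, mul_ite, mul_zero, ite_mul, zero_mul,
        Finset.sum_ite_eq', Finset.mem_univ, if_true, raiseConf_rotK_zero, one_mul]
    rw [dotProduct]
    simp only [this]
    rw [sum_eq_three hn _ fun a ha => by
      rw [rotM_of_three_le ha, mul_zero]]
    simp [rotK, rotM]
    ring
  rw [h.ricci_k_k (Set.mem_univ x), hμ, accel_rotK, raiseConf_rotM, add_dotProduct, h3, h4,
    rotM_dot_rotM hn]
  simp only [h1, h2, pd_const]
  norm_num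

theorem not_isGeodetic_rot (hn : 3 ≤ n) : ¬ IsGeodetic Set.univ rotMetric (rotK : Field n) := by
  rw [(ksChart_rot hn).isGeodetic_iff, accel_rotK]
  rintro ⟨f, hf⟩
  have := hf 0 (Set.mem_univ 0) ⟨2, by omega⟩
  simp [rotK, rotM] at this

end Example

end XKS

theorem mainTheorem11 (n : ℕ) [NeZero n] (hn : 3 ≤ n) (Λ : ℝ) :
    -- a geodetic Kerr–Schild vector forces the component `T_{00}` to vanish
    (∀ (U : Set (XKS.Pt n)) (gbar g T : XKS.Tensor2 n) (H K : XKS.Scalar n) (k m : XKS.Field n),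
      IsOpen U → XKS.IsExtendedKerrSchild U gbar g H K k m →
      XKS.EinsteinEquations U Λ g T →
      XKS.IsGeodetic U g k → ∀ x ∈ U, XKS.T00 g T k x = 0) ∧
    -- the equivalence under the Lie derivative conditions
    (∀ (U : Set (XKS.Pt n)) (gbar g T : XKS.Tensor2 n) (H K : XKS.Scalar n) (k m : XKS.Field n),
      IsOpen U → XKS.IsExtendedKerrSchild U gbar g H K k m →
      XKS.EinsteinEquations U Λ g T →
      XKS.ProportionalOn U (XKS.lieDeriv (XKS.raise g k) m) m →
      (∀ x ∈ U, XKS.lieDeriv (XKS.raise g m) k x = 0) →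
      U ⊆ closure {x ∈ U | 4 * H x ≠ K x ^ 2} →
      (XKS.IsGeodetic U g k ↔ ∀ x ∈ U, XKS.T00 g T k x = 0)) ∧
    -- without the Lie derivative conditions the converse fails in general
    (∃ (gbar g T : XKS.Tensor2 n) (H K : XKS.Scalar n) (k m : XKS.Field n),
      XKS.IsExtendedKerrSchild Set.univ gbar g H K k m ∧
      XKS.EinsteinEquations Set.univ Λ g T ∧
      (∀ x, K x ≠ 0) ∧ (∀ x, 4 * H x ≠ K x ^ 2) ∧
      (∀ x, XKS.T00 g T k x = 0) ∧ ¬ XKS.IsGeodetic Set.univ g k) := by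
  refine ⟨?_, ?_, ?_⟩
  · intro U gbar g T H K k m hU h hE hgeo x hx
    obtain ⟨p, q, hc⟩ := h.exists_chart hn hU
    exact hc.T00_eq_zero_of_isGeodetic hE hgeo hx
  · intro U gbar g T H K k m hU h hE hkm hmk hdense
    obtain ⟨p, q, hc⟩ := h.exists_chart hn hU
    exact ⟨fun hgeo x hx => hc.T00_eq_zero_of_isGeodetic hE hgeo hx, fun hT =>
      hc.isGeodetic_of_T00_eq_zero hE h.k_ne_zero hkm hmk hdense hT⟩
  · have hc := XKS.ksChart_rot hn
    have hconf : ∀ x : XKS.Pt n, XKS.confMetric 0 1 x = XKS.minkowski n := by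
      intro x
      rw [XKS.confMetric, XKS.affine_zero_one]; simp
    have hE : XKS.EinsteinEquations (n := n) Set.univ Λ XKS.rotMetric fun x => Matrix.of fun a b =>
        (XKS.ricci XKS.rotMetric x a b
          - (1 / 2) * XKS.ricciScalar XKS.rotMetric x * XKS.rotMetric x a b
          + Λ * XKS.rotMetric x a b) / (8 * Real.pi) := by
      intro x _ a b
      simp only [Matrix.of_apply]
      field_simp
    refine ⟨fun _ => XKS.minkowski n, XKS.rotMetric, _, fun _ => 0, fun _ => 1, XKS.rotK,
      XKS.rotM, ?_, hE, fun _ => one_ne_zero, fun _ => by norm_num, fun x => ?_,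
      XKS.not_isGeodetic_rot hn⟩
    · have hmem : ∀ x : XKS.Pt n, x ∈ Set.univ := Set.mem_univ
      refine ⟨⟨fun _ => 1, Or.inl fun _ _ => rfl, fun x _ => (one_smul _ _).symm⟩,
        contDiffOn_const, contDiffOn_const,
        (contDiff_pi.2 XKS.contDiff_rotK).contDiffOn,
        (contDiff_pi.2 XKS.contDiff_rotM).contDiffOn, fun x _ a b => ?_, fun x _ h0 => ?_,
        fun x _ => ?_, fun x _ => ?_, fun x _ => ?_⟩
      · rw [← hconf x]
        simp only [XKS.rotMetric, Matrix.sub_apply, Matrix.add_apply, Matrix.smul_apply,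
          Matrix.vecMulVec_apply, smul_eq_mul]
        ring
      · have := congrFun h0 0
        simp [XKS.rotK] at this
      · exact (dotProduct_comm _ _).trans (by rw [hc.raise_k (hmem x)]; exact hc.kX (hmem x))
      · exact (dotProduct_comm _ _).trans (by rw [hc.raise_k (hmem x)]; exact hc.mX (hmem x))
      · exact (dotProduct_comm _ _).trans (by
          rw [hc.raise_m (hmem x)]; exact (hc.ksPoint (hmem x)).mM)
    · have h8 := hc.einstein_T00 (Set.mem_univ x) hE
      rw [XKS.ricci_rot hn x] at h8
      exact (mul_eq_zero.1 h8).resolve_left (by positivity)
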